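/- Let $D\subset\mathbb R^n$ be a nonempty bounded convex polyhedron and let $G:D\to\mathbb R$ be continuous and strictly convex in the sense that $G$ is convex and is not constant on any segment $[x,y]\subset D$ with $x\ne y$ (this holds in particular if $G$ is strictly convex in the usual sense). Let $D_0$ be the set of vertices of $D$, $g^*=\min_D G$, $g_{\max}=\max_D G$ and $U_g=\{x\in D: G(x)<g\}$. Write $x\succsim y$ if there is a continuous path in $D$ from $x$ to $y$ along which $G$ does not increase, $x\sim y$ if $x\succsim y\succsim x$, and let $\pi:D\to\mathcal T=D/{\sim}$ be the projection onto the tree of $G$ in $D$, partially ordered by $\pi(x)\succsim\pi(y)\iff x\succsim y$. Label every vertex $v$ of the graph of the 1-skeleton of $D$ by $G(v)$ and every edge $e$ by $\min_e G$, and let $\Gamma_g$ be the graph obtained by deleting all vertices and edges with labels $<g$. For $x\in D$ let $W(x)$ be the path-connected component of $D\setminus U_{G(x)}$ that contains $x$. Then $\pi(x)\mapsto(G(x),W(x)\cap D_0)$ is a well-defined bijection from $\mathcal T$ onto the set of pairs $(g,M)$ where $g^*\le g\le g_{\max}$ and $M$ is the vertex set of a connected component of $\Gamma_g$; points of $\mathcal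 T$ are identified with these pairs. For such an $M$, let $Q_M$ be the set of minimizers of $G$ on the outer edges of $M$, i.e. the edges of $D$ that join a vertex in $M$ to a vertex in $D_0\setminus M$, and let $\underline a_M=\inf\{g:(g,M)\in\mathcal T\}$, $\overline a_M=\sup\{g:(g,M)\in\mathcal T\}$. 1. For every point $(g,M)\in\mathcal T$, $$\pi^{-1}(g,M)=\{x\in\operatorname{conv}(Q_M\cup M): G(x)=g\}.$$ 2. Let $M$ be such that $(g,M)\in\mathcal T$ for some $g$, and let $H\subset(\underline a_M,\overline a_M]$ or, if $M=D_0$, $H\subset[\underline a_M,\overline a_M]$. Then $H\times M:=\{(h,M):h\in H\}\subset\mathcal T$ and $$\pi^{-1}(H\times M)=\{x\in\operatorname{conv}(Q_M\cup M): G(x)\in H\}.$$ 3. For every $M$ as in 2 there is a unique maximal chain $M=M_1\subsetneq M_2\subsetneq\dots\subsetneq M_k$ of sets $M_i$ such that each $M_i$ is the vertex set of a connected component of $\Gamma_g$ for some $g\in[g^*,g_{\max}]$, and $M_k=D_0$. 4. Put $Att(x)=\{y\in D:x\succsim y\}$ for $x\in D$ and $Att(z)=\{w\in\mathcal T:z\succsim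 w\}$ for $z\in\mathcal T$. Then $Att(x)=\pi^{-1}(Att(\pi(x)))$. If $(g,M)\in\mathcal T$, $M_1,\dots,M_k$ is the chain from 3, $\underline a_i=\underline a_{M_i}$ and $\underline a_0:=g$, then $$Att(g,M)=\bigcup_{i=1}^{k} J_i\times M_i,\qquad J_i=(\underline a_i,\underline a_{i-1}]\ (i<k),\quad J_k=[\underline a_k,\underline a_{k-1}],$$ and for every $x\in D$ with $\pi(x)=(g,M)$, $$Att(x)=\bigcup_{i=1}^{k}\{y\in\operatorname{conv}(Q_{M_i}\cup M_i): G(y)\in J_i\}.$$ -/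

import Mathlib

open Set

/-- A bounded convex polyhedron (convex polytope): the convex hull of a nonempty finite set. -/
def IsPolytope {n : ℕ} (D : Set (EuclideanSpace ℝ (Fin n))) : Prop :=
  ∃ S : Set (EuclideanSpace ℝ (Fin n)), S.Finite ∧ S.Nonempty ∧ D = convexHull ℝ S

/-- `G` is convex on `D` and is not constant on any nondegenerate segment contained in `D`. This is
implied by `StrictConvexOn ℝ D G`. -/
def StrictlyConvexIn {n : ℕ} (D : Set (EuclideanSpace ℝ (Fin n)))
    (G : EuclideanSpace ℝ (Fin n) → ℝ) : Prop :=
  ConvexOn ℝ D G ∧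
    ∀ x ∈ D, ∀ y ∈ D, x ≠ y → ¬ ∃ c : ℝ, ∀ z ∈ segment ℝ x y, G z = c

/-- The set `D₀` of vertices of `D`. -/
def vertexSet {n : ℕ} (D : Set (EuclideanSpace ℝ (Fin n))) : Set (EuclideanSpace ℝ (Fin n)) :=
  D.extremePoints ℝ

/-- The graph of the 1-skeleton of `D`: two distinct vertices are adjacent when the closed segment
between them is a face (an extreme subset) of `D`. -/
def skeletonGraph {n : ℕ} (D : Set (EuclideanSpace ℝ (Fin n))) :
    SimpleGraph (vertexSet D) where
  Adj v w := v ≠ w ∧ IsExtreme ℝ D (segment ℝ v.1 w.1)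
  symm := ⟨fun v w h => ⟨h.1.symm, by rw [segment_symm]; exact h.2⟩⟩
  loopless := ⟨fun _ h => h.1 rfl⟩

/-- The label `g_e` of the edge `e = [v, w]`: the minimal value of `G` on it. -/
noncomputable def edgeLabel {n : ℕ} (G : EuclideanSpace ℝ (Fin n) → ℝ)
    (v w : EuclideanSpace ℝ (Fin n)) : ℝ :=
  sInf (G '' segment ℝ v w)

/-- The sublevel set `U_g = {x ∈ D | G x < g}`. -/
def sublevelSet {n : ℕ} (D : Set (EuclideanSpace ℝ (Fin n)))
    (G : EuclideanSpace ℝ (Fin n) → ℝ) (g : ℝ) : Set (EuclideanSpace ℝ (Fin n)) :=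
  {x ∈ D | G x < g}

/-- The graph of the 1-skeleton after deletion of all vertices and edges with labels `< g`. -/
def cutGraph {n : ℕ} (D : Set (EuclideanSpace ℝ (Fin n)))
    (G : EuclideanSpace ℝ (Fin n) → ℝ) (g : ℝ) :
    SimpleGraph {v : vertexSet D // g ≤ G v.1} where
  Adj v w := (skeletonGraph D).Adj v.1 w.1 ∧ g ≤ edgeLabel G v.1.1 w.1.1
  symm := ⟨fun v w h => ⟨h.1.symm, by
    have h2 := h.2
    unfold edgeLabel at h2 ⊢
    rwa [segment_symm]⟩⟩
  loopless := ⟨fun v h => (skeletonGraph D).loopless.irrefl v.1 h.1⟩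

/-- `M` is the vertex set of a connected component of `cutGraph D G g`. -/
def IsComponentVertexSet {n : ℕ} (D : Set (EuclideanSpace ℝ (Fin n)))
    (G : EuclideanSpace ℝ (Fin n) → ℝ) (g : ℝ) (M : Set (EuclideanSpace ℝ (Fin n))) : Prop :=
  ∃ C : (cutGraph D G g).ConnectedComponent, M = (fun v => v.1.1) '' C.supp

/-- The pairs `(g, M)` with `min_D G ≤ g ≤ max_D G` and `M` the vertex set of a connected component
of the graph `cutGraph D G g`. -/
def treePairs {n : ℕ} (D : Set (EuclideanSpace ℝ (Fin n)))
    (G : EuclideanSpace ℝ (Fin n) → ℝ) : Set (ℝ × Set (EuclideanSpace ℝ (Fin n))) :=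
  {p | sInf (G '' D) ≤ p.1 ∧ p.1 ≤ sSup (G '' D) ∧ IsComponentVertexSet D G p.1 p.2}

/-- `x ≿ y`: there is a continuous path in `D` from `x` to `y` along which `G` does not increase. -/
def Precedes {n : ℕ} (D : Set (EuclideanSpace ℝ (Fin n)))
    (G : EuclideanSpace ℝ (Fin n) → ℝ) (x y : D) : Prop :=
  ∃ φ : Path x y, Antitone fun t => G (φ t)

theorem Precedes.refl {n : ℕ} {D : Set (EuclideanSpace ℝ (Fin n))}
    {G : EuclideanSpace ℝ (Fin n) → ℝ} (x : D) : Precedes D G x x :=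
  ⟨Path.refl x, fun _ _ _ => le_refl _⟩

theorem Precedes.le {n : ℕ} {D : Set (EuclideanSpace ℝ (Fin n))}
    {G : EuclideanSpace ℝ (Fin n) → ℝ} {x y : D} (h : Precedes D G x y) : G y ≤ G x := by
  obtain ⟨φ, hφ⟩ := h
  simpa using hφ (zero_le_one : (0 : unitInterval) ≤ 1)

theorem Precedes.trans {n : ℕ} {D : Set (EuclideanSpace ℝ (Fin n))}
    {G : EuclideanSpace ℝ (Fin n) → ℝ} {x y z : D}
    (hxy : Precedes D G x y) (hyz : Precedes D G y z) : Precedes D G x z := by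
  obtain ⟨φ, hφ⟩ := hxy
  obtain ⟨ψ, hψ⟩ := hyz
  refine ⟨φ.trans ψ, fun s t hst => ?_⟩
  have hst' : (s : ℝ) ≤ t := hst
  simp only [Path.trans_apply]
  split_ifs with ht hs hs
  · exact hφ (Subtype.mk_le_mk.2 (by linarith))
  · exact absurd (hst'.trans ht) hs
  · refine le_trans (b := G y) ?_ ?_
    · simpa using hψ (unitInterval.nonneg' : (0 : unitInterval) ≤ _)
    · simpa using hφ (unitInterval.le_one' : _ ≤ (1 : unitInterval))
  · exact hψ (Subtype.mk_le_mk.2 (by linarith))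

/-- The equivalence `x ∼ y`: `x ≿ y` and `y ≿ x`. -/
def admissibleSetoid {n : ℕ} (D : Set (EuclideanSpace ℝ (Fin n)))
    (G : EuclideanSpace ℝ (Fin n) → ℝ) : Setoid D where
  r x y := Precedes D G x y ∧ Precedes D G y x
  iseqv := ⟨fun x => ⟨.refl x, .refl x⟩, fun h => ⟨h.2, h.1⟩,
    fun h k => ⟨h.1.trans k.1, k.2.trans h.2⟩⟩

/-- The tree of `G` in `D`: the quotient `D / ∼`. -/
def ThermoTree {n : ℕ} (D : Set (EuclideanSpace ℝ (Fin n)))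
    (G : EuclideanSpace ℝ (Fin n) → ℝ) : Type :=
  Quotient (admissibleSetoid D G)

/-- The natural projection `π : D → ThermoTree D G`. -/
def treeProj {n : ℕ} (D : Set (EuclideanSpace ℝ (Fin n)))
    (G : EuclideanSpace ℝ (Fin n) → ℝ) (x : D) : ThermoTree D G :=
  Quotient.mk (admissibleSetoid D G) x

/-- The order on the tree: `π x ≿ π y` if and only if `x ≿ y`. -/
def ThermoTree.Precedes {n : ℕ} {D : Set (EuclideanSpace ℝ (Fin n))}
    {G : EuclideanSpace ℝ (Fin n) → ℝ} (z w : ThermoTree D G) : Prop :=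
  Quotient.liftOn₂ z w (_root_.Precedes D G) fun _ _ _ _ ha hb =>
    propext ⟨fun h => (ha.2.trans h).trans hb.1, fun h => (ha.1.trans h).trans hb.2⟩

/-- `W(x)`: the path-connected component of `D \ U_g`, `g = G x`, that contains `x`. -/
def upperComponent {n : ℕ} (D : Set (EuclideanSpace ℝ (Fin n)))
    (G : EuclideanSpace ℝ (Fin n) → ℝ) (x : EuclideanSpace ℝ (Fin n)) :
    Set (EuclideanSpace ℝ (Fin n)) :=
  pathComponentIn (D \ sublevelSet D G (G x)) x

theorem upperComponent_eq {n : ℕ} {D : Set (EuclideanSpace ℝ (Fin n))}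
    {G : EuclideanSpace ℝ (Fin n) → ℝ} {x y : D}
    (h : Precedes D G x y ∧ Precedes D G y x) :
    upperComponent D G x = upperComponent D G y := by
  have hG : G y = G x := le_antisymm h.1.le h.2.le
  unfold upperComponent
  rw [hG]
  obtain ⟨φ, hφ⟩ := h.1
  have hj : JoinedIn (D \ sublevelSet D G (G x)) (x : EuclideanSpace ℝ (Fin n)) y := by
    refine ⟨φ.map continuous_subtype_val, fun t => ⟨(φ t).2, fun hU => ?_⟩⟩
    have h1 : G y ≤ G (φ t) := by
      simpa using hφ (unitInterval.le_one' : t ≤ (1 : unitInterval))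
    have h2 : G (φ t) < G x := hU.2
    linarith
  exact (pathComponentIn_congr hj).symm

/-- The coordinates of a point of the tree: `π x ↦ (G x, W(x) ∩ D₀)`. -/
def ThermoTree.coord {n : ℕ} {D : Set (EuclideanSpace ℝ (Fin n))}
    {G : EuclideanSpace ℝ (Fin n) → ℝ} (z : ThermoTree D G) :
    ℝ × Set (EuclideanSpace ℝ (Fin n)) :=
  Quotient.liftOn z (fun x : D => (G x, upperComponent D G x ∩ vertexSet D)) fun _ _ h =>
    Prod.ext (le_antisymm (Precedes.le h.2) (Precedes.le h.1))
      (congrArg (· ∩ vertexSet D) (upperComponent_eq h))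

/-- The outer edges of `M`: the edges of `D` connecting `M` with `D₀ \ M`. -/
def outerEdges {n : ℕ} (D M : Set (EuclideanSpace ℝ (Fin n))) :
    Set (Set (EuclideanSpace ℝ (Fin n))) :=
  {e | ∃ v w : vertexSet D, (skeletonGraph D).Adj v w ∧ v.1 ∈ M ∧ w.1 ∉ M ∧
    e = segment ℝ v.1 w.1}

/-- `Q_M`: the minimizers of `G` on the outer edges of `M`. -/
def outerMinimizers {n : ℕ} (D : Set (EuclideanSpace ℝ (Fin n)))
    (G : EuclideanSpace ℝ (Fin n) → ℝ) (M : Set (EuclideanSpace ℝ (Fin n))) :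
    Set (EuclideanSpace ℝ (Fin n)) :=
  {x | ∃ e ∈ outerEdges D M, x ∈ e ∧ IsMinOn G e x}

/-- The infimum of the values `g` for which `(g, M)` is a point of the tree. -/
noncomputable def lowerValue {n : ℕ} (D : Set (EuclideanSpace ℝ (Fin n)))
    (G : EuclideanSpace ℝ (Fin n) → ℝ) (M : Set (EuclideanSpace ℝ (Fin n))) : ℝ :=
  sInf {g | (g, M) ∈ treePairs D G}

/-- The supremum of the values `g` for which `(g, M)` is a point of the tree. -/
noncomputable def upperValue {n : ℕ} (D : Set (EuclideanSpace ℝ (Fin n)))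
    (G : EuclideanSpace ℝ (Fin n) → ℝ) (M : Set (EuclideanSpace ℝ (Fin n))) : ℝ :=
  sSup {g | (g, M) ∈ treePairs D G}

/-- The set attainable from `x` in `D`. -/
def attainableSet {n : ℕ} (D : Set (EuclideanSpace ℝ (Fin n)))
    (G : EuclideanSpace ℝ (Fin n) → ℝ) (x : D) : Set D :=
  {y | Precedes D G x y}

/-- The set attainable from `z` in the tree. -/
def ThermoTree.attainableSet {n : ℕ} {D : Set (EuclideanSpace ℝ (Fin n))}
    {G : EuclideanSpace ℝ (Fin n) → ℝ} (z : ThermoTree D G) : Set (ThermoTree D G) :=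
  {w | z.Precedes w}

/-- A lower chain of `M`: components `M = C 0 ⊊ C 1 ⊊ ⋯ ⊊ C k` (each for some level of `G`). -/
def IsLowerChain {n : ℕ} (D : Set (EuclideanSpace ℝ (Fin n)))
    (G : EuclideanSpace ℝ (Fin n) → ℝ) (M : Set (EuclideanSpace ℝ (Fin n))) {k : ℕ}
    (C : Fin (k + 1) → Set (EuclideanSpace ℝ (Fin n))) : Prop :=
  C 0 = M ∧ StrictMono C ∧ ∀ i, ∃ g, (g, C i) ∈ treePairs D G

/-- A maximal lower chain of `M`: one that is not contained in a longer lower chain of `M`. -/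
def IsMaximalLowerChain {n : ℕ} (D : Set (EuclideanSpace ℝ (Fin n)))
    (G : EuclideanSpace ℝ (Fin n) → ℝ) (M : Set (EuclideanSpace ℝ (Fin n))) {k : ℕ}
    (C : Fin (k + 1) → Set (EuclideanSpace ℝ (Fin n))) : Prop :=
  IsLowerChain D G M C ∧
    ∀ (l : ℕ) (C' : Fin (l + 1) → Set (EuclideanSpace ℝ (Fin n))),
      IsLowerChain D G M C' → range C ⊆ range C' → range C' = range C

/-- The interval of values of `G` that belongs to the `i`-th member of a chain `C`, starting from
the value `g`. With `a i = lowerValue D G (C i)` it is `(a i, a (i - 1)]`, where `a (i - 1)` is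
replaced by `g` for `i = 0` and the left end is included for the last `i`. -/
noncomputable def chainInterval {n : ℕ} (D : Set (EuclideanSpace ℝ (Fin n)))
    (G : EuclideanSpace ℝ (Fin n) → ℝ) (g : ℝ) {k : ℕ}
    (C : Fin (k + 1) → Set (EuclideanSpace ℝ (Fin n))) (i : Fin (k + 1)) : Set ℝ :=
  let upper : ℝ := Fin.cases g (fun j : Fin k => lowerValue D G (C j.castSucc)) i
  if i = Fin.last k then Icc (lowerValue D G (C i)) upper
  else Ioc (lowerValue D G (C i)) upper

/-! The key fact identifies the path component in `D \ U_g` of a vertex `v` with `G v ≥ g`. Let `M`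
be the set of vertices reached from `v` through edges of label at least `g`, and `Q` the set of
minimizers on the outer edges of `M`. Every outer edge has label `< g`, since otherwise its far end
would lie in `M`; hence `conv Q ⊆ U_g` by convexity of `G`. The hulls `conv (Q ∪ M)` and `conv (Q ∪
(D₀ \ M))` cover `D` and meet only in `conv Q`. Above level `g` they are therefore disjoint closed
sets, and a connected set there lies in one of them (`IsPolytope.pathComponentIn_eq`).

The statement on the two hulls rests on the simplex method. From a vertex where a functional is not
maximal, some edge leads to a larger value. So the vertices in an open half-space missing `Q` are
linked by edges missing `Q`, and lie all in `M` or all outside it (`mem_of_forall_functional_lt`).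

Admissible paths reduce to connectivity: `x ≿ y` iff `x` and `y` are joined in `{G ≥ G y}`
(`precedes_iff_joinedIn`), because a path above a level can be pushed radially towards the minimizer
of `G` into the level set. Every point is also reached from some vertex, so components are
determined by their vertices. Thus `x ≿ y` iff `G y ≤ G x` and `W(x) ∩ D₀ ⊆ W(y) ∩ D₀`
(`IsStrictMinimizer.precedes_iff`).

The rest is combinatorics of finitely many labels. Components grow as `g` decreases, so those
containing `M` form a finite chain. Each one lives on an interval of levels, and the intervals of
consecutive members abut. -/

section ConvexGeometry

/-! ### Separating functionals and their generic perturbations. -/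

variable {E : Type*} [NormedAddCommGroup E] [NormedSpace ℝ E]

theorem exists_functional_lt_of_notMem_convexHull {Q : Set E} (hQ : Q.Finite) {x : E}
    (hx : x ∉ convexHull ℝ Q) : ∃ f : StrongDual ℝ E, ∀ q ∈ Q, f q < f x := by
  obtain ⟨f, u, h1, h2⟩ := geometric_hahn_banach_closed_point (convex_convexHull ℝ Q)
    (hQ.isClosed_convexHull ℝ) hx
  exact ⟨f, fun q hq => (h1 q (subset_convexHull ℝ Q hq)).trans h2⟩

theorem exists_le_functional_of_mem_convexHull {Q : Set E} {x : E} (hx : x ∈ convexHull ℝ Q)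
    (f : StrongDual ℝ E) : ∃ q ∈ Q, f x ≤ f q :=
  ConvexOn.exists_ge_of_mem_convexHull (s := univ) (f.toLinearMap.convexOn convex_univ)
    (subset_univ Q) hx

/-- A real vector space, here the dual, is not a finite union of proper subspaces. -/
theorem exists_functional_forall_ne_zero {F : Set E} (hF : F.Finite) (h0 : ∀ e ∈ F, e ≠ 0) :
    ∃ m : StrongDual ℝ E, ∀ e ∈ F, m e ≠ 0 := by
  have := hF.to_subtype
  obtain ⟨m, -, hm⟩ := Module.Dual.exists_forall_mem_ne_zero_of_forall_exists
    (K := ℝ) (M := StrongDual ℝ E) ⊤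
    (fun e : F => (ContinuousLinearMap.apply ℝ ℝ e.1).toLinearMap) (fun e => by
      obtain ⟨g, hg⟩ := SeparatingDual.exists_ne_zero (R := ℝ) (h0 e.1 e.2)
      exact ⟨g, Submodule.mem_top, hg⟩)
  exact ⟨m, fun e he => hm ⟨e, he⟩⟩

/-- A functional which is positive on a finite set can be perturbed so as not to vanish at any of
finitely many given nonzero vectors. -/
theorem exists_functional_pos_and_ne_zero {P F : Set E} (hP : P.Finite) (hF : F.Finite)
    (h0 : ∀ e ∈ F, e ≠ 0) (f : StrongDual ℝ E) (hf : ∀ p ∈ P, 0 < f p) :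
    ∃ f' : StrongDual ℝ E, (∀ p ∈ P, 0 < f' p) ∧ ∀ e ∈ F, f' e ≠ 0 := by
  obtain ⟨m, hm⟩ := exists_functional_forall_ne_zero hF h0
  have hlim : ∀ z : E, Filter.Tendsto (fun ε : ℝ => f z + ε * m z) (nhdsWithin 0 (Ioi 0))
      (nhds (f z)) := fun z => by
    have : Continuous fun ε : ℝ => f z + ε * m z := by fun_prop
    simpa using (this.tendsto 0).mono_left nhdsWithin_le_nhds
  have h1 : ∀ᶠ ε : ℝ in nhdsWithin 0 (Ioi 0), ∀ p ∈ P, 0 < f p + ε * m p :=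
    (Filter.eventually_all_finite hP).2 fun p hp => (hlim p).eventually (lt_mem_nhds (hf p hp))
  have h2 : ∀ᶠ ε : ℝ in nhdsWithin 0 (Ioi 0), ∀ e ∈ F, f e + ε * m e ≠ 0 :=
    (Filter.eventually_all_finite hF).2 fun e he => by
      by_cases hfe : f e = 0
      · filter_upwards [self_mem_nhdsWithin] with ε hε
        rw [hfe, zero_add]
        exact mul_ne_zero (ne_of_gt hε) (hm e he)
      · exact (hlim e).eventually (isOpen_ne.mem_nhds hfe)
  obtain ⟨ε, h1, h2⟩ := (h1.and h2).exists
  exact ⟨f + ε • m, fun p hp => by simpa using h1 p hp, fun e he => by simpa using h2 e he⟩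

/-- Equality would put `u` and `w` on one ray from `v`, so the nearer of them would be interior to a
segment of `D`. This makes the ratio test in `exists_adj_lt` generically free of ties. -/
theorem smul_sub_ne_smul_sub_of_extremePoints {D : Set E} {v u w : E} (hv : v ∈ D)
    (hu : u ∈ D.extremePoints ℝ) (hw : w ∈ D.extremePoints ℝ) (hvu : v ≠ u) (hvw : v ≠ w)
    (huw : u ≠ w) {a b : ℝ} (ha : 0 < a) (hb : 0 < b) : b • (v - u) ≠ a • (v - w) := by
  wlog hab : a ≤ b generalizing u w a b
  · exact (this hw hu hvw hvu huw.symm hb ha (le_of_not_ge hab)).symm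
  intro h
  have hb' := hb.ne'
  rcases hab.eq_or_lt with rfl | hlt
  · have := smul_right_injective E hb' h
    exact huw (sub_right_injective this)
  · have hmem : u ∈ openSegment ℝ v w := by
      refine ⟨1 - a / b, a / b, sub_pos.2 ((div_lt_one hb).2 hlt), div_pos ha hb, by ring, ?_⟩
      have h2 : v - u = (a / b) • (v - w) := by
        rw [div_eq_inv_mul, mul_smul, ← h, smul_smul, inv_mul_cancel₀ hb', one_smul]
      have h3 : u = v - (a / b) • (v - w) := by rw [← h2]; abel
      rw [h3]
      module
    exact hvu (hu.2 hv hw.1 hmem)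

end ConvexGeometry

/-! ### The simplex method and the splitting of a polytope by its edges. -/

section Polytope

variable {n : ℕ} {D : Set (EuclideanSpace ℝ (Fin n))}

namespace IsPolytope

theorem isCompact (hD : IsPolytope D) : IsCompact D := by
  obtain ⟨S, hS, -, rfl⟩ := hD
  exact hS.isCompact_convexHull ℝ

theorem convex (hD : IsPolytope D) : Convex ℝ D := by
  obtain ⟨S, -, -, rfl⟩ := hD
  exact convex_convexHull ℝ S

theorem nonempty (hD : IsPolytope D) : D.Nonempty := by
  obtain ⟨S, -, hS, rfl⟩ := hD
  exact hS.convexHull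

theorem finite_vertexSet (hD : IsPolytope D) : (vertexSet D).Finite := by
  obtain ⟨S, hS, -, rfl⟩ := hD
  exact hS.subset extremePoints_convexHull_subset

theorem convexHull_vertexSet (hD : IsPolytope D) : convexHull ℝ (vertexSet D) = D := by
  conv_rhs => rw [← closure_convexHull_extremePoints hD.isCompact hD.convex]
  exact (hD.finite_vertexSet.isClosed_convexHull ℝ).closure_eq.symm

/-- The face of `D` where `k` is maximal is the closed hull of the vertices in it, and these can
only be `v` and `w`. -/
theorem isExtreme_segment (hD : IsPolytope D) {v w : EuclideanSpace ℝ (Fin n)}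
    (hv : v ∈ vertexSet D) (hw : w ∈ vertexSet D) (k : StrongDual ℝ (EuclideanSpace ℝ (Fin n)))
    (hvw : k w = k v) (hk : ∀ u ∈ vertexSet D, u ≠ v → u ≠ w → k u < k v) :
    IsExtreme ℝ D (segment ℝ v w) := by
  have hle : ∀ y ∈ D, k y ≤ k v := fun y hy => by
    rw [← hD.convexHull_vertexSet] at hy
    obtain ⟨u, hu, hyu⟩ := exists_le_functional_of_mem_convexHull hy k
    refine hyu.trans ?_
    by_cases h1 : u = v
    · rw [h1]
    by_cases h2 : u = w
    · rw [h2, hvw]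
    exact (hk u hu h1 h2).le
  have hF : IsExposed ℝ D {x | x ∈ D ∧ ∀ y ∈ D, k y ≤ k x} := fun _ => ⟨k, rfl⟩
  have heq : {x | x ∈ D ∧ ∀ y ∈ D, k y ≤ k x} = segment ℝ v w := by
    apply Subset.antisymm
    · conv_lhs => rw [← closure_convexHull_extremePoints (hF.isCompact hD.isCompact)
        (hF.convex hD.convex), hF.isExtreme.extremePoints_eq]
      rw [← convexHull_pair]
      refine closure_minimal (convexHull_mono ?_)
        ((toFinite {v, w}).isClosed_convexHull ℝ)
      rintro u ⟨⟨-, h1⟩, h2⟩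
      by_contra h3
      simp only [mem_insert_iff, mem_singleton_iff, not_or] at h3
      exact (hk u h2 h3.1 h3.2).not_ge (h1 v hv.1)
    · refine (convex_iff_segment_subset.1 (hF.convex hD.convex)) ⟨hv.1, hle⟩ ⟨hw.1, ?_⟩
      rwa [hvw]
  rw [← heq]
  exact hF.isExtreme

/-- The improvement step of the simplex method. -/
theorem exists_adj_lt (hD : IsPolytope D) (ℓ : StrongDual ℝ (EuclideanSpace ℝ (Fin n)))
    (v : vertexSet D) {u : EuclideanSpace ℝ (Fin n)} (hu : u ∈ vertexSet D) (hlt : ℓ v.1 < ℓ u) :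
    ∃ w : vertexSet D, (skeletonGraph D).Adj v w ∧ ℓ v.1 < ℓ w.1 := by
  have hfin := hD.finite_vertexSet
  obtain ⟨v, hv⟩ := v
  have hnot : v ∉ convexHull ℝ (vertexSet D \ {v}) := fun h => by
    refine (hD.convex.mem_extremePoints_iff_mem_sdiff_convexHull_sdiff.1 hv).2 ?_
    exact convexHull_mono (sdiff_subset_sdiff_left fun x hx => hx.1) h
  obtain ⟨f, hf⟩ := exists_functional_lt_of_notMem_convexHull (hfin.subset sdiff_subset) hnot
  -- Positivity on `P` keeps `v` the strict maximum of `h` among the vertices. Nonvanishing on `F`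
  -- makes the ratios `(h v - h x) / (ℓ x - ℓ v)` of distinct improving vertices distinct.
  obtain ⟨h, hpos, hne⟩ := exists_functional_pos_and_ne_zero
    (P := (fun x => v - x) '' (vertexSet D \ {v}))
    (F := (fun p : EuclideanSpace ℝ (Fin n) × EuclideanSpace ℝ (Fin n) =>
      (ℓ p.2 - ℓ v) • (v - p.1) - (ℓ p.1 - ℓ v) • (v - p.2)) ''
        {p | p ∈ vertexSet D ×ˢ vertexSet D ∧ ℓ v < ℓ p.1 ∧ ℓ v < ℓ p.2 ∧ p.1 ≠ p.2})
    ((hfin.subset sdiff_subset).image _)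
    (((hfin.prod hfin).subset fun p hp => hp.1).image _)
    (by
      rintro _ ⟨⟨x, y⟩, ⟨⟨hx, hy⟩, h1, h2, h3⟩, rfl⟩
      refine sub_ne_zero.2 (smul_sub_ne_smul_sub_of_extremePoints hv.1 hx hy ?_ ?_ h3
        (sub_pos.2 h1) (sub_pos.2 h2))
      · rintro rfl; exact h1.false
      · rintro rfl; exact h2.false)
    f (by
      rintro _ ⟨x, hx, rfl⟩
      simpa using hf x hx)
  -- Ratio test: the least ratio `t` is the first coefficient at which `h + t • ℓ` stops having `v`
  -- as its only maximum; there only `w` ties with `v`, so `[v, w]` is an edge.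
  obtain ⟨w, ⟨hw, hvw⟩, hmin⟩ := exists_min_image {x | x ∈ vertexSet D ∧ ℓ v < ℓ x}
    (fun x => (h v - h x) / (ℓ x - ℓ v)) (hfin.subset fun x hx => hx.1) ⟨u, hu, hlt⟩
  have hne' : w ≠ v := by rintro rfl; exact hvw.false
  have hpos' : ∀ x ∈ vertexSet D, x ≠ v → h x < h v := fun x hx hxv => by
    simpa using hpos _ ⟨x, ⟨hx, hxv⟩, rfl⟩
  set t := (h v - h w) / (ℓ w - ℓ v) with ht
  have htpos : 0 < t := div_pos (sub_pos.2 (hpos' w hw hne')) (sub_pos.2 hvw)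
  have htw : t * (ℓ w - ℓ v) = h v - h w := div_mul_cancel₀ _ (sub_pos.2 hvw).ne'
  refine ⟨⟨w, hw⟩, ⟨fun heq => hne' (congrArg Subtype.val heq).symm,
    hD.isExtreme_segment hv hw (h + t • ℓ) ?_ ?_⟩, hvw⟩
  · simp only [add_apply, smul_apply, smul_eq_mul]
    linarith
  · intro x hx hxv hxw
    simp only [add_apply, smul_apply, smul_eq_mul]
    by_cases hlx : ℓ v < ℓ x
    · have h1 : t ≤ (h v - h x) / (ℓ x - ℓ v) := hmin x ⟨hx, hlx⟩
      have h2 := hne _ ⟨(x, w), ⟨⟨hx, hw⟩, hlx, hvw, hxw⟩, rfl⟩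
      rw [le_div_iff₀ (sub_pos.2 hlx)] at h1
      have h3 : t * (ℓ x - ℓ v) ≠ h v - h x := fun h4 => h2 (by
        simp only [map_sub, map_smul, smul_eq_mul]
        rw [← h4, ← htw]
        ring)
      have := lt_of_le_of_ne h1 h3
      linarith
    · have h1 := mul_le_mul_of_nonneg_left (not_lt.1 hlx) htpos.le
      have := hpos' x hx hxv
      linarith

/-- If the finite set `Q` meets every edge between `M` and its complement, then the vertices in an
open half-space whose complement contains `Q` all belong to `M` or all to its complement. -/
theorem mem_of_forall_functional_lt (hD : IsPolytope D)
    {Q M : Set (EuclideanSpace ℝ (Fin n))} (hQ : Q.Finite)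
    (hQM : ∀ v w : vertexSet D, (skeletonGraph D).Adj v w → v.1 ∈ M → w.1 ∉ M →
      ∃ q ∈ Q, q ∈ segment ℝ v.1 w.1)
    (f : StrongDual ℝ (EuclideanSpace ℝ (Fin n))) {u v : EuclideanSpace ℝ (Fin n)}
    (hu : u ∈ vertexSet D) (hv : v ∈ vertexSet D) (hfu : ∀ q ∈ Q, f q < f u)
    (hfv : ∀ q ∈ Q, f q < f v) (huM : u ∈ M) : v ∈ M := by
  have hfin := hD.finite_vertexSet
  -- Perturb `f` so that it separates all vertices, while `u` and `v` stay above `Q`; the maximal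
  -- vertex `m` is then unique.
  obtain ⟨ℓ, hpos, hne⟩ := exists_functional_pos_and_ne_zero
    (P := (fun p : EuclideanSpace ℝ (Fin n) × EuclideanSpace ℝ (Fin n) => p.1 - p.2) ''
      ({u, v} ×ˢ Q))
    (F := (fun p : EuclideanSpace ℝ (Fin n) × EuclideanSpace ℝ (Fin n) => p.1 - p.2) ''
      {p | p ∈ vertexSet D ×ˢ vertexSet D ∧ p.1 ≠ p.2})
    (((toFinite {u, v}).prod hQ).image _)
    (((hfin.prod hfin).subset fun p hp => hp.1).image _)
    (by
      rintro _ ⟨⟨x, y⟩, ⟨-, h⟩, rfl⟩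
      exact sub_ne_zero.2 h)
    f (by
      rintro _ ⟨⟨x, q⟩, ⟨hx, hq⟩, rfl⟩
      rw [map_sub, sub_pos]
      rcases hx with hx | hx
      · simp only at hx; rw [hx]; exact hfu q hq
      · simp only [mem_singleton_iff] at hx; rw [hx]; exact hfv q hq)
  obtain ⟨m, hm, hmax⟩ := exists_max_image (vertexSet D) ℓ hfin ⟨u, hu⟩
  have key : ∀ a : EuclideanSpace ℝ (Fin n), a ∈ vertexSet D → (∀ q ∈ Q, ℓ q < ℓ a) →
      (a ∈ M ↔ m ∈ M) := by
    by_contra! hcon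
    -- Take the highest counterexample. Its improving neighbour `w` is on the side of `m`, so the
    -- edge `[a, w]` contains a point of `Q`, although `ℓ ≥ ℓ a` on that edge.
    obtain ⟨a, ⟨ha, haQ, haM⟩, hamax⟩ := exists_max_image
      {a | a ∈ vertexSet D ∧ (∀ q ∈ Q, ℓ q < ℓ a) ∧ ¬ (a ∈ M ↔ m ∈ M)} ℓ
      (hfin.subset fun a ha => ha.1) (by
        obtain ⟨a, h1, h2, h3⟩ := hcon
        exact ⟨a, h1, h2, by tauto⟩)
    have ham : a ≠ m := by rintro rfl; exact haM Iff.rfl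
    have hlt : ℓ a < ℓ m := lt_of_le_of_ne (hmax a ha) fun h => by
      refine hne _ ⟨(a, m), ⟨⟨ha, hm⟩, ham⟩, rfl⟩ ?_
      simp [h]
    obtain ⟨w, hadj, hw⟩ := hD.exists_adj_lt ℓ ⟨a, ha⟩ hm hlt
    have hwQ : ∀ q ∈ Q, ℓ q < ℓ w.1 := fun q hq => (haQ q hq).trans hw
    have hwM : w.1 ∈ M ↔ m ∈ M := by
      by_contra h
      exact hw.not_ge (hamax w.1 ⟨w.2, hwQ, h⟩)
    have hex : ∃ q ∈ Q, q ∈ segment ℝ a w.1 := by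
      by_cases h : a ∈ M
      · exact hQM ⟨a, ha⟩ w hadj h (by tauto)
      · obtain ⟨q, h1, h2⟩ := hQM w ⟨a, ha⟩ hadj.symm (by tauto) h
        exact ⟨q, h1, by rwa [segment_symm]⟩
    obtain ⟨q, hq, hqs⟩ := hex
    have hcv : Convex ℝ {x | ℓ a ≤ ℓ x} := convex_halfSpace_ge ℓ.toLinearMap.isLinear _
    have : ℓ a ≤ ℓ q := (convex_iff_segment_subset.1 hcv) (le_refl (ℓ a)) hw.le hqs
    exact (haQ q hq).not_ge this
  have hl : ∀ x ∈ ({u, v} : Set (EuclideanSpace ℝ (Fin n))), ∀ q ∈ Q, ℓ q < ℓ x :=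
    fun x hx q hq => by simpa using hpos _ ⟨(x, q), ⟨hx, hq⟩, rfl⟩
  exact (key v hv (hl v (by simp))).2 ((key u hu (hl u (by simp))).1 huM)

section Separation

variable {Q M : Set (EuclideanSpace ℝ (Fin n))}

/-- If `Q` meets every edge between `M` and its complement, then `conv (Q ∪ M)` and
`conv (Q ∪ (D₀ \ M))` intersect only in `conv Q`. -/
theorem mem_convexHull_of_mem_of_mem (hD : IsPolytope D) (hQ : Q.Finite)
    (hQM : ∀ v w : vertexSet D, (skeletonGraph D).Adj v w → v.1 ∈ M → w.1 ∉ M →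
      ∃ q ∈ Q, q ∈ segment ℝ v.1 w.1) (hM : M ⊆ vertexSet D)
    {x : EuclideanSpace ℝ (Fin n)} (h1 : x ∈ convexHull ℝ (Q ∪ M))
    (h2 : x ∈ convexHull ℝ (Q ∪ (vertexSet D \ M))) : x ∈ convexHull ℝ Q := by
  by_contra hx
  obtain ⟨f, hf⟩ := exists_functional_lt_of_notMem_convexHull hQ hx
  obtain ⟨u, hu, hxu⟩ := exists_le_functional_of_mem_convexHull h1 f
  obtain ⟨v, hv, hxv⟩ := exists_le_functional_of_mem_convexHull h2 f
  have hu := hu.resolve_left fun h => (hf u h).not_ge hxu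
  have hv := hv.resolve_left fun h => (hf v h).not_ge hxv
  exact hv.2 (hD.mem_of_forall_functional_lt hQ hQM f (hM hu) hv.1
    (fun q hq => (hf q hq).trans_le hxu) (fun q hq => (hf q hq).trans_le hxv) hu)

/-- If `Q` meets every edge between `M` and its complement, then `conv (Q ∪ M)` and
`conv (Q ∪ (D₀ \ M))` cover the polytope. -/
theorem mem_convexHull_union_or (hD : IsPolytope D) (hQ : Q.Finite)
    (hQM : ∀ v w : vertexSet D, (skeletonGraph D).Adj v w → v.1 ∈ M → w.1 ∉ M →
      ∃ q ∈ Q, q ∈ segment ℝ v.1 w.1) (hM : M ⊆ vertexSet D)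
    {x : EuclideanSpace ℝ (Fin n)} (hx : x ∈ D) :
    x ∈ convexHull ℝ (Q ∪ M) ∨ x ∈ convexHull ℝ (Q ∪ (vertexSet D \ M)) := by
  have hfin := hD.finite_vertexSet
  by_contra! hcon
  obtain ⟨f, hf⟩ := exists_functional_lt_of_notMem_convexHull (hQ.union (hfin.subset hM)) hcon.1
  obtain ⟨g, hg⟩ := exists_functional_lt_of_notMem_convexHull
    (hQ.union (hfin.subset sdiff_subset)) hcon.2
  -- Move from `f` to `g` along `f + t • (g - f)`. At every `t` some vertex is at least as high as
  -- `x`; at `t = 0` it lies outside `M`, at `t = 1` inside. By connectedness of `[0, 1]` both kinds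
  -- occur for a common `t`, while `Q` stays strictly below `x`.
  have hcont : ∀ v : EuclideanSpace ℝ (Fin n),
      IsClosed {t : ℝ | (f + t • (g - f)) x ≤ (f + t • (g - f)) v} := fun v => by
    simp only [add_apply, smul_apply, smul_eq_mul]
    exact isClosed_le (by fun_prop) (by fun_prop)
  have hclosed : ∀ N ⊆ vertexSet D,
      IsClosed (⋃ v ∈ N, {t : ℝ | (f + t • (g - f)) x ≤ (f + t • (g - f)) v}) :=
    fun N hN => (hfin.subset hN).isClosed_biUnion fun v _ => hcont v
  have hex : ∀ t : ℝ, ∃ v ∈ vertexSet D, (f + t • (g - f)) x ≤ (f + t • (g - f)) v := fun t =>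
    exists_le_functional_of_mem_convexHull (by rwa [hD.convexHull_vertexSet]) _
  obtain ⟨t, ht, h1, h2⟩ := isPreconnected_closed_iff.1 (isPreconnected_Icc (a := (0 : ℝ)) (b := 1))
    _ _ (hclosed M hM) (hclosed (vertexSet D \ M) sdiff_subset)
    (fun t _ => by
      obtain ⟨v, hv, h⟩ := hex t
      by_cases hvM : v ∈ M
      · exact Or.inl (mem_biUnion hvM h)
      · exact Or.inr (mem_biUnion (show v ∈ vertexSet D \ M from ⟨hv, hvM⟩) h))
    ⟨1, by simp, by
      obtain ⟨v, hv, h⟩ := hex 1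
      have hvM : v ∈ M := by
        by_contra hvM
        have := hg v (Or.inr ⟨hv, hvM⟩)
        simp at h
        linarith
      exact mem_biUnion hvM h⟩
    ⟨0, by simp, by
      obtain ⟨v, hv, h⟩ := hex 0
      have hvM : v ∉ M := fun hvM => by
        have := hf v (Or.inr hvM)
        simp at h
        linarith
      exact mem_biUnion (show v ∈ vertexSet D \ M from ⟨hv, hvM⟩) h⟩
  simp only [mem_iUnion] at h1 h2
  obtain ⟨u, hu, hxu⟩ := h1
  obtain ⟨v, hv, hxv⟩ := h2
  have hq : ∀ q ∈ Q, (f + t • (g - f)) q < (f + t • (g - f)) x := fun q hq => by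
    have h1 := hf q (Or.inl hq)
    have h2 := hg q (Or.inl hq)
    simp only [add_apply, smul_apply,
      sub_apply, smul_eq_mul]
    rcases ht.2.eq_or_lt with rfl | ht1
    · linarith
    · nlinarith [mul_nonneg ht.1 (sub_pos.2 h2).le, mul_pos (sub_pos.2 ht1) (sub_pos.2 h1)]
  exact hv.2 (hD.mem_of_forall_functional_lt hQ hQM _ (hM hu) hv.1
    (fun q h => (hq q h).trans_le hxu) (fun q h => (hq q h).trans_le hxv) hu)

end Separation

end IsPolytope

end Polytope

/-! ### Paths along which `G` does not increase. -/

section Paths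

variable {n : ℕ} {D : Set (EuclideanSpace ℝ (Fin n))} {G : EuclideanSpace ℝ (Fin n) → ℝ}

theorem ConvexOn.comp_lineMap_Icc (hG : ConvexOn ℝ D G) {x y : EuclideanSpace ℝ (Fin n)}
    (hx : x ∈ D) (hy : y ∈ D) :
    ConvexOn ℝ (Icc (0 : ℝ) 1) fun t => G (AffineMap.lineMap x y t) :=
  (hG.comp_affineMap (AffineMap.lineMap x y)).subset
    (fun _ ht => hG.1.lineMap_mem hx hy ht) (convex_Icc 0 1)

/-- If a convex function attains its minimum on a segment at its end point, then it does not
increase along the segment. -/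
theorem precedes_of_forall_le (hG : ConvexOn ℝ D G) {x y : D}
    (h : ∀ z ∈ segment ℝ x.1 y.1, G y ≤ G z) : Precedes D G x y := by
  have hc := hG.comp_lineMap_Icc x.2 y.2
  have hcont : Continuous fun t : unitInterval =>
      (AffineMap.lineMap x.1 y.1 (t : ℝ) : EuclideanSpace ℝ (Fin n)) :=
    AffineMap.lineMap_continuous.comp continuous_subtype_val
  refine ⟨⟨⟨fun t => ⟨AffineMap.lineMap x.1 y.1 (t : ℝ), hG.1.lineMap_mem x.2 y.2 t.2⟩,
    hcont.subtype_mk _⟩, by simp, by simp⟩, fun s t hst => ?_⟩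
  have h1 : (t : ℝ) ∈ segment ℝ (s : ℝ) 1 := by
    rw [segment_eq_Icc s.2.2]
    exact ⟨hst, t.2.2⟩
  have h2 := hc.le_on_segment s.2 (right_mem_Icc.2 zero_le_one) h1
  simp only [AffineMap.lineMap_apply_one] at h2
  exact h2.trans (max_le le_rfl (h _ (mem_segment_iff_wbtw.2 ⟨s, s.2, rfl⟩)))

theorem Precedes.joinedIn {x y : D} (h : Precedes D G x y) {g : ℝ} (hg : g ≤ G y) :
    JoinedIn {z ∈ D | g ≤ G z} x.1 y.1 := by
  obtain ⟨φ, hφ⟩ := h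
  refine ⟨φ.map continuous_subtype_val, fun t => ⟨(φ t).2, hg.trans ?_⟩⟩
  simpa using hφ (unitInterval.le_one' : t ≤ (1 : unitInterval))

/-- If neither half of the segment descends to `x`, there are points with smaller `G` on both sides
of `x`, against convexity. -/
theorem precedes_or_precedes_of_mem_segment (hG : ConvexOn ℝ D G) {a b x : D}
    (hx : x.1 ∈ segment ℝ a.1 b.1) : Precedes D G a x ∨ Precedes D G b x := by
  by_contra! h
  have h1 : ∃ z ∈ segment ℝ a.1 x.1, G z < G x := by
    by_contra! h'
    exact h.1 (precedes_of_forall_le hG h')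
  have h2 : ∃ z ∈ segment ℝ b.1 x.1, G z < G x := by
    by_contra! h'
    exact h.2 (precedes_of_forall_le hG h')
  obtain ⟨z, hz, hzx⟩ := h1
  obtain ⟨w, hw, hwx⟩ := h2
  rw [segment_symm] at hw
  have hzD : z ∈ D := hG.1.segment_subset a.2 x.2 hz
  have hwD : w ∈ D := hG.1.segment_subset x.2 b.2 hw
  rw [mem_segment_iff_wbtw] at hx hz hw
  have h3 : Wbtw ℝ z x.1 w := (hx.trans_left_right hz).trans_right_left hw
  exact (hG.le_on_segment hzD hwD (mem_segment_iff_wbtw.2 h3)).not_gt (max_lt hzx hwx)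

/-- The hull of `insert a s` consists of segments from `a` to points of `conv s`, so the segment
lemma feeds an induction on the number of generators. -/
theorem exists_precedes_of_mem_convexHull (hG : ConvexOn ℝ D G)
    (t : Finset (EuclideanSpace ℝ (Fin n))) (ht : (t : Set (EuclideanSpace ℝ (Fin n))) ⊆ D)
    (x : D) (hx : x.1 ∈ convexHull ℝ (t : Set (EuclideanSpace ℝ (Fin n)))) :
    ∃ v : D, v.1 ∈ t ∧ Precedes D G v x := by
  induction t using Finset.induction_on generalizing x with
  | empty => simp at hx
  | insert a s ha ih =>
    rw [Finset.coe_insert] at hx ht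
    have haD : a ∈ D := ht (mem_insert _ _)
    have hsD := (subset_insert _ _).trans ht
    rcases s.eq_empty_or_nonempty with rfl | hs
    · have : x.1 = a := by simpa using hx
      exact ⟨x, by simp [this], .refl x⟩
    rw [convexHull_insert (by simpa using hs), mem_convexJoin] at hx
    obtain ⟨a', ha', y, hy, hxs⟩ := hx
    rw [mem_singleton_iff] at ha'
    subst ha'
    have hyD : y ∈ D := convexHull_min hsD hG.1 hy
    rcases precedes_or_precedes_of_mem_segment hG (a := ⟨a', haD⟩) (b := ⟨y, hyD⟩) hxs with h | h
    · exact ⟨_, by simp, h⟩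
    · obtain ⟨v, hv, hvy⟩ := ih hsD ⟨y, hyD⟩ hy
      exact ⟨v, Finset.mem_insert_of_mem hv, hvy.trans h⟩

/-- Every point can be reached from a vertex along a path on which `G` does not increase. -/
theorem IsPolytope.exists_vertex_precedes (hD : IsPolytope D) (hG : ConvexOn ℝ D G) (x : D) :
    ∃ v : D, v.1 ∈ vertexSet D ∧ Precedes D G v x := by
  have hfin := hD.finite_vertexSet
  obtain ⟨v, hv, h⟩ := exists_precedes_of_mem_convexHull hG hfin.toFinset
    (by rw [hfin.coe_toFinset]; exact fun x hx => hx.1) x (by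
      rw [hfin.coe_toFinset, hD.convexHull_vertexSet]
      exact x.2)
  exact ⟨v, by simpa using hv, h⟩

/-- Moving towards a minimizer one attains all lower values of `G`. -/
theorem exists_precedes_of_mem_Icc (hG : ConvexOn ℝ D G) (hcont : ContinuousOn G D) {p : D}
    (hp : ∀ z ∈ D, G p ≤ G z) (x : D) {g : ℝ} (hg : g ∈ Icc (G p) (G x)) :
    ∃ y : D, G y = g ∧ Precedes D G x y := by
  have hsub := hG.1.segment_subset x.2 p.2
  obtain ⟨y, hy, rfl⟩ := (convex_segment (𝕜 := ℝ) x.1 p.1).isPreconnected.intermediate_value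
    (right_mem_segment ℝ x.1 p.1) (left_mem_segment ℝ x.1 p.1) (hcont.mono hsub) hg
  refine ⟨⟨y, hsub hy⟩, rfl, precedes_of_forall_le hG fun z hz => ?_⟩
  have hzD : z ∈ D := hG.1.segment_subset x.2 (hsub hy) hz
  rw [mem_segment_iff_wbtw] at hy hz
  have h1 := hG.le_on_segment hzD p.2 (mem_segment_iff_wbtw.2 (hy.trans_left_right hz))
  rcases le_max_iff.1 h1 with h2 | h2
  · exact h2
  · exact h2.trans (hp z hzD)

/-- The preimage of a closed set is the projection of a closed set along the compact factor `Y`,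
hence closed. -/
theorem exists_continuous_of_existsUnique {X Y : Type*} [TopologicalSpace X]
    [TopologicalSpace Y] [CompactSpace Y] {F : X × Y → ℝ} (hF : Continuous F) {c : ℝ}
    (h : ∀ x, ∃! y, F (x, y) = c) : ∃ f : X → Y, Continuous f ∧ ∀ x, F (x, f x) = c := by
  choose f hf huniq using h
  refine ⟨f, continuous_iff_isClosed.2 fun C hC => ?_, hf⟩
  have : f ⁻¹' C = Prod.fst '' ({q : X × Y | F q = c} ∩ Prod.snd ⁻¹' C) := by
    ext x
    constructor
    · exact fun hx => ⟨(x, f x), ⟨hf x, hx⟩, rfl⟩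
    · rintro ⟨⟨x', y⟩, ⟨h1, h2⟩, rfl⟩
      have h2 : y ∈ C := h2
      exact huniq x' y h1 ▸ h2
  rw [this]
  exact isClosedMap_fst_of_compactSpace _
    ((isClosed_eq hF continuous_const).inter (hC.preimage continuous_snd))

/-- Two points of the same level which are joined above this level are joined in the level set. -/
theorem precedes_of_joinedIn (hG : StrictlyConvexIn D G) (hcont : ContinuousOn G D) {p : D}
    (hp : ∀ z ∈ D, G p ≤ G z) {x y : D} (hxy : G x = G y)
    (h : JoinedIn {z ∈ D | G x ≤ G z} x.1 y.1) : Precedes D G x y := by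
  -- At the minimal level `G` would be constant on `[x, y]`, which forces `x = y`.
  rcases (hp x x.2).eq_or_lt with hpx | hpx
  · have heq : x = y := by
      by_contra hne
      refine hG.2 x x.2 y y.2 (fun h => hne (Subtype.ext h)) ⟨G x, fun z hz => le_antisymm ?_ ?_⟩
      · simpa [hxy] using hG.1.le_on_segment x.2 y.2 hz
      · exact hpx ▸ hp z (hG.1.1.segment_subset x.2 y.2 hz)
    rw [heq]
    exact .refl y
  -- Push `φ` radially towards `p`: on `[p, φ s]` the convex function starts below `G x` and ends at
  -- or above it, so it takes the value `G x` exactly once. Uniqueness also makes the hitting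
  -- parameter `τ` continuous and equal to `1` at both ends.
  obtain ⟨φ, hφ⟩ := h
  have hmem : ∀ (s t : unitInterval), AffineMap.lineMap p.1 (φ s) (t : ℝ) ∈ D :=
    fun s t => hG.1.1.lineMap_mem p.2 (hφ s).1 t.2
  have hlm : Continuous fun q : unitInterval × unitInterval =>
      (AffineMap.lineMap p.1 (φ q.1) (q.2 : ℝ) : EuclideanSpace ℝ (Fin n)) := by
    have h1 : Continuous fun q : unitInterval × unitInterval => φ q.1 :=
      φ.continuous.comp continuous_fst
    simp only [AffineMap.lineMap_apply_module]
    exact ((continuous_const.sub (continuous_subtype_val.comp continuous_snd)).smul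
      continuous_const).add ((continuous_subtype_val.comp continuous_snd).smul h1)
  have hGc : Continuous fun q : unitInterval × unitInterval =>
      G (AffineMap.lineMap p.1 (φ q.1) (q.2 : ℝ)) :=
    hcont.comp_continuous hlm fun q => hmem q.1 q.2
  have hex : ∀ s : unitInterval, ∃ t : unitInterval,
      G (AffineMap.lineMap p.1 (φ s) (t : ℝ)) = G x := fun s => by
    have h1 : ContinuousOn G (segment ℝ p.1 (φ s)) :=
      hcont.mono (hG.1.1.segment_subset p.2 (hφ s).1)
    obtain ⟨y, hy, hyx⟩ := (convex_segment (𝕜 := ℝ) p.1 (φ s)).isPreconnected.intermediate_value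
      (left_mem_segment ℝ _ _) (right_mem_segment ℝ _ _) h1 ⟨hpx.le, (hφ s).2⟩
    obtain ⟨t, ht, rfl⟩ := mem_segment_iff_wbtw.1 hy
    exact ⟨⟨t, ht⟩, hyx⟩
  have huniq_lt : ∀ s t t' : unitInterval, t < t' →
      G (AffineMap.lineMap p.1 (φ s) (t : ℝ)) = G x →
      G (AffineMap.lineMap p.1 (φ s) (t' : ℝ)) ≠ G x := fun s t t' htt h1 h2 => by
    have hc := hG.1.comp_lineMap_Icc p.2 (hφ s).1
    have ht0 : (0 : ℝ) < t := by
      refine lt_of_le_of_ne t.2.1 fun h => ?_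
      rw [← h, AffineMap.lineMap_apply_zero] at h1
      exact hpx.ne h1
    have ht' : (t : ℝ) < t' := htt
    have h3 := hc.lt_right_of_left_lt (left_mem_Icc.2 zero_le_one) t'.2 (z := (t : ℝ))
      (by rw [openSegment_eq_Ioo (ht0.trans ht')]; exact ⟨ht0, ht'⟩)
      (by simpa [h1] using hpx)
    simp only [h1, h2, lt_self_iff_false] at h3
  have huniq : ∀ s t t' : unitInterval, G (AffineMap.lineMap p.1 (φ s) (t : ℝ)) = G x →
      G (AffineMap.lineMap p.1 (φ s) (t' : ℝ)) = G x → t = t' := fun s t t' h1 h2 => by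
    rcases lt_trichotomy t t' with h | h | h
    · exact absurd h2 (huniq_lt s t t' h h1)
    · exact h
    · exact absurd h1 (huniq_lt s t' t h h2)
  obtain ⟨τ, hτc, hτ⟩ := exists_continuous_of_existsUnique hGc (c := G x) fun s =>
    (hex s).imp fun t ht => ⟨ht, fun t' ht' => huniq s t' t ht' ht⟩
  have hτ0 : τ 0 = 1 := huniq 0 _ _ (hτ 0) (by simp)
  have hτ1 : τ 1 = 1 := huniq 1 _ _ (hτ 1) (by simp [hxy])
  refine ⟨⟨⟨fun s => ⟨AffineMap.lineMap p.1 (φ s) (τ s : ℝ), hmem s (τ s)⟩,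
    (hlm.comp (continuous_id.prodMk hτc)).subtype_mk _⟩, ?_, ?_⟩, fun s t _ => ?_⟩
  · simp [hτ0]
  · simp [hτ1]
  · exact ((hτ t).trans (hτ s).symm).le

/-- `x ≿ y` if and only if `G y ≤ G x` and `x`, `y` are joined above the level of `y`. -/
theorem precedes_iff_joinedIn (hG : StrictlyConvexIn D G) (hcont : ContinuousOn G D) {p : D}
    (hp : ∀ z ∈ D, G p ≤ G z) {x y : D} :
    Precedes D G x y ↔ JoinedIn {z ∈ D | G y ≤ G z} x.1 y.1 := by
  refine ⟨fun h => h.joinedIn le_rfl, fun h => ?_⟩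
  -- First descend from `x` to the level of `y`, then travel within that level.
  obtain ⟨x', hx', hxx'⟩ := exists_precedes_of_mem_Icc hG.1 hcont hp x
    ⟨hp y y.2, h.source_mem.2⟩
  refine hxx'.trans (precedes_of_joinedIn hG hcont hp hx' ?_)
  rw [hx']
  exact (hxx'.joinedIn hx'.ge).symm.trans h

end Paths

/-! ### Components of superlevel sets and of the labelled graph. -/

/-- Two vertices are joined by an edge with label at least `g`. -/
def LabelRel {n : ℕ} (D : Set (EuclideanSpace ℝ (Fin n))) (G : EuclideanSpace ℝ (Fin n) → ℝ)
    (g : ℝ) (v w : EuclideanSpace ℝ (Fin n)) : Prop :=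
  ∃ (hv : v ∈ vertexSet D) (hw : w ∈ vertexSet D),
    (skeletonGraph D).Adj ⟨v, hv⟩ ⟨w, hw⟩ ∧ g ≤ edgeLabel G v w

/-- The vertices which are joined to `v` by a chain of edges with labels at least `g`. -/
def labelReach {n : ℕ} (D : Set (EuclideanSpace ℝ (Fin n))) (G : EuclideanSpace ℝ (Fin n) → ℝ)
    (g : ℝ) (v : EuclideanSpace ℝ (Fin n)) : Set (EuclideanSpace ℝ (Fin n)) :=
  {w | Relation.ReflTransGen (LabelRel D G g) v w}

section Components

variable {n : ℕ} {D : Set (EuclideanSpace ℝ (Fin n))} {G : EuclideanSpace ℝ (Fin n) → ℝ}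
  {g h : ℝ} {v w : EuclideanSpace ℝ (Fin n)}

theorem LabelRel.symm (hvw : LabelRel D G g v w) : LabelRel D G g w v := by
  obtain ⟨hv, hw, h1, h2⟩ := hvw
  refine ⟨hw, hv, h1.symm, ?_⟩
  unfold edgeLabel at h2 ⊢
  rwa [segment_symm]

theorem LabelRel.mono (hgh : g ≤ h) (hvw : LabelRel D G h v w) : LabelRel D G g v w := by
  obtain ⟨hv, hw, h1, h2⟩ := hvw
  exact ⟨hv, hw, h1, hgh.trans h2⟩

theorem mem_labelReach_self : v ∈ labelReach D G g v := Relation.ReflTransGen.refl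

theorem labelReach_anti (hgh : g ≤ h) : labelReach D G h v ⊆ labelReach D G g v :=
  fun w hw => (Relation.ReflTransGen.mono
    (fun _ _ h1 => LabelRel.mono hgh h1 : LabelRel D G h ≤ LabelRel D G g)) v w hw

theorem labelReach_eq (hw : w ∈ labelReach D G g v) : labelReach D G g w = labelReach D G g v := by
  have : Std.Symm (LabelRel D G g) := ⟨fun _ _ => LabelRel.symm⟩
  have hsymm : Relation.ReflTransGen (LabelRel D G g) w v :=
    (Relation.ReflTransGen.stdSymm (r := LabelRel D G g)).symm _ _ hw
  exact Subset.antisymm (fun u hu => Relation.ReflTransGen.trans hw hu)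
    fun u hu => hsymm.trans hu

theorem labelReach_subset_vertexSet (hv : v ∈ vertexSet D) :
    labelReach D G g v ⊆ vertexSet D := fun w hw => by
  rcases Relation.ReflTransGen.cases_tail hw with rfl | ⟨u, -, h⟩
  · exact hv
  · exact h.2.1

theorem edgeLabel_spec (hD : Convex ℝ D) (hcont : ContinuousOn G D) (hv : v ∈ D) (hw : w ∈ D) :
    (∃ q ∈ segment ℝ v w, G q = edgeLabel G v w) ∧ ∀ z ∈ segment ℝ v w, edgeLabel G v w ≤ G z := by
  have hc : IsCompact (segment ℝ v w) := by
    rw [← convexHull_pair]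
    exact (toFinite {v, w}).isCompact_convexHull ℝ
  have hne : (segment ℝ v w).Nonempty := ⟨v, left_mem_segment ℝ v w⟩
  have hcont' := hcont.mono (hD.segment_subset hv hw)
  obtain ⟨q, hq, hq', -⟩ := hc.exists_sInf_image_eq_and_le hne hcont'
  exact ⟨⟨q, hq, hq'.symm⟩, fun z hz => csInf_le (hc.image_of_continuousOn hcont').bddBelow
    (mem_image_of_mem G hz)⟩

theorem le_of_mem_labelReach (hD : Convex ℝ D) (hcont : ContinuousOn G D) (hg : g ≤ G v)
    (hw : w ∈ labelReach D G g v) : g ≤ G w := by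
  rcases Relation.ReflTransGen.cases_tail hw with rfl | ⟨u, -, h1, h2, -, h3⟩
  · exact hg
  · exact h3.trans ((edgeLabel_spec hD hcont h1.1 h2.1).2 w (right_mem_segment ℝ u w))

/-- Replaces components of graphs whose vertex types depend on `g` by reachability in the ambient
space, where different levels can be compared. -/
theorem isComponentVertexSet_iff (hD : Convex ℝ D) (hcont : ContinuousOn G D)
    {M : Set (EuclideanSpace ℝ (Fin n))} :
    IsComponentVertexSet D G g M ↔ ∃ v ∈ vertexSet D, g ≤ G v ∧ M = labelReach D G g v := by
  have key : ∀ a : {v : vertexSet D // g ≤ G v.1},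
      (fun v => v.1.1) '' ((cutGraph D G g).connectedComponentMk a).supp =
        labelReach D G g a.1.1 := fun a => by
    ext w
    constructor
    · rintro ⟨b, hb, rfl⟩
      have hb : (cutGraph D G g).Reachable a b := (SimpleGraph.ConnectedComponent.eq.1 hb).symm
      rw [SimpleGraph.reachable_iff_reflTransGen] at hb
      have hstep : ∀ x y, (cutGraph D G g).Adj x y → LabelRel D G g x.1.1 y.1.1 :=
        fun x y hxy => ⟨x.1.2, y.1.2, hxy.1, hxy.2⟩
      exact hb.lift (fun v => v.1.1) hstep
    · intro hw
      induction hw with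
      | refl => exact ⟨a, rfl, rfl⟩
      | @tail b c hb hbc ih =>
        obtain ⟨b', hb', rfl⟩ := ih
        obtain ⟨h1, h2, h3, h4⟩ := hbc
        have hgc : g ≤ G c := h4.trans
          ((edgeLabel_spec hD hcont h1.1 h2.1).2 c (right_mem_segment ℝ b'.1.1 c))
        have hadj : (cutGraph D G g).Adj b' ⟨⟨c, h2⟩, hgc⟩ := ⟨h3, h4⟩
        exact ⟨⟨⟨c, h2⟩, hgc⟩,
          (SimpleGraph.ConnectedComponent.eq.2 hadj.reachable.symm).trans hb', rfl⟩
  constructor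
  · rintro ⟨C, rfl⟩
    induction C using SimpleGraph.ConnectedComponent.ind with
    | h a => exact ⟨a.1.1, a.1.2, a.2, key a⟩
  · rintro ⟨v, hv, hg, rfl⟩
    exact ⟨(cutGraph D G g).connectedComponentMk ⟨⟨v, hv⟩, hg⟩, (key ⟨⟨v, hv⟩, hg⟩).symm⟩

/-- Each edge has only one minimizer: between two of them `G` would be constant. -/
theorem IsPolytope.finite_outerMinimizers (hD : IsPolytope D) (hG : StrictlyConvexIn D G)
    (M : Set (EuclideanSpace ℝ (Fin n))) : (outerMinimizers D G M).Finite := by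
  have hfin := hD.finite_vertexSet
  refine ((hfin.prod hfin).biUnion
    (t := fun p => {x | x ∈ segment ℝ p.1 p.2 ∧ IsMinOn G (segment ℝ p.1 p.2) x})
    fun p hp => Subsingleton.finite ?_).subset ?_
  · rintro x ⟨hx, hx'⟩ y ⟨hy, hy'⟩
    have hsub := hD.convex.segment_subset hp.1.1 hp.2.1
    by_contra hne
    refine hG.2 x (hsub hx) y (hsub hy) hne ⟨G x, fun z hz => le_antisymm ?_ ?_⟩
    · exact (hG.1.le_on_segment (hsub hx) (hsub hy) hz).trans (max_le le_rfl (hy' hx))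
    · exact hx' ((convex_segment p.1 p.2).segment_subset hx hy hz)
  · rintro x ⟨_, ⟨v, w, -, -, -, rfl⟩, hx, hmin⟩
    exact mem_biUnion (show (v.1, w.1) ∈ vertexSet D ×ˢ vertexSet D from ⟨v.2, w.2⟩) ⟨hx, hmin⟩

theorem outerMinimizers_subset (hD : Convex ℝ D) (M : Set (EuclideanSpace ℝ (Fin n))) :
    outerMinimizers D G M ⊆ D := by
  rintro q ⟨_, ⟨v, w, -, -, -, rfl⟩, hq, -⟩
  exact hD.segment_subset v.2.1 w.2.1 hq

theorem exists_mem_outerMinimizers (hD : Convex ℝ D) (hcont : ContinuousOn G D)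
    {M : Set (EuclideanSpace ℝ (Fin n))} (v w : vertexSet D) (hadj : (skeletonGraph D).Adj v w)
    (hv : v.1 ∈ M) (hw : w.1 ∉ M) : ∃ q ∈ outerMinimizers D G M, q ∈ segment ℝ v.1 w.1 := by
  obtain ⟨⟨q, hq, hq'⟩, hle⟩ := edgeLabel_spec hD hcont v.2.1 w.2.1
  exact ⟨q, ⟨_, ⟨v, w, hadj, hv, hw, rfl⟩, hq, fun z hz => (hq'.trans_le (hle z hz) : G q ≤ G z)⟩,
    hq⟩

/-- An outer edge whose minimum is at least `g` would make its outer end reachable. -/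
theorem lt_of_mem_outerMinimizers (hD : Convex ℝ D) (hcont : ContinuousOn G D)
    {q : EuclideanSpace ℝ (Fin n)} (hq : q ∈ outerMinimizers D G (labelReach D G g v)) :
    G q < g := by
  obtain ⟨_, ⟨a, b, hadj, ha, hb, rfl⟩, hqs, hmin⟩ := hq
  obtain ⟨⟨z, hz, hz'⟩, -⟩ := edgeLabel_spec hD hcont a.2.1 b.2.1
  by_contra! hle
  exact hb (Relation.ReflTransGen.tail ha ⟨a.2, b.2, hadj, (hle.trans (hmin hz)).trans hz'.le⟩)

theorem joinedIn_of_mem_labelReach (hD : Convex ℝ D) (hcont : ContinuousOn G D)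
    (hv : v ∈ D) (hg : g ≤ G v) (hw : w ∈ labelReach D G g v) :
    JoinedIn {z ∈ D | g ≤ G z} v w := by
  induction hw with
  | refl => exact JoinedIn.refl ⟨hv, hg⟩
  | @tail b c _ hbc ih =>
    obtain ⟨hb, hc, -, hle⟩ := hbc
    refine ih.trans (JoinedIn.of_segment_subset fun z hz => ⟨?_, hle.trans ?_⟩)
    · exact hD.segment_subset hb.1 hc.1 hz
    · exact (edgeLabel_spec hD hcont hb.1 hc.1).2 z hz

theorem IsPolytope.mem_of_vertex_mem_convexHull (hD : IsPolytope D)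
    {S : Set (EuclideanSpace ℝ (Fin n))} (hS : S ⊆ D) (hv : v ∈ vertexSet D)
    (h : v ∈ convexHull ℝ S) : v ∈ S :=
  extremePoints_convexHull_subset (inter_extremePoints_subset_extremePoints_of_subset
    (convexHull_min hS hD.convex) ⟨h, hv⟩)

/-- The path component of a vertex `v` in `D \ U_g` is the part of `conv (Q_M ∪ M)` above the
level `g`, where `M` is the set of vertices joined to `v` by edges with labels at least `g`. -/
theorem IsPolytope.pathComponentIn_eq (hD : IsPolytope D) (hcont : ContinuousOn G D)
    (hG : StrictlyConvexIn D G) (hv : v ∈ vertexSet D) (hg : g ≤ G v) :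
    pathComponentIn {z ∈ D | g ≤ G z} v =
      {x ∈ convexHull ℝ (outerMinimizers D G (labelReach D G g v) ∪ labelReach D G g v) |
        g ≤ G x} := by
  set M := labelReach D G g v
  set Q := outerMinimizers D G M
  have hMV : M ⊆ vertexSet D := labelReach_subset_vertexSet hv
  have hVD : vertexSet D ⊆ D := fun x hx => hx.1
  have hQD : Q ⊆ D := outerMinimizers_subset hD.convex M
  have hQ : Q.Finite := hD.finite_outerMinimizers hG M
  have hQM := exists_mem_outerMinimizers hD.convex hcont (M := M)
  have hQg : ∀ x ∈ convexHull ℝ Q, G x < g := fun x hx => by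
    obtain ⟨q, hq, hxq⟩ := hG.1.exists_ge_of_mem_convexHull hQD hx
    exact hxq.trans_lt (lt_of_mem_outerMinimizers hD.convex hcont hq)
  have hfin := hD.finite_vertexSet
  -- Above level `g` the two closed hulls cover and are disjoint, since they meet only in `conv Q`,
  -- where `G < g`.
  have hsplit : ∀ u ∈ {z ∈ D | g ≤ G z},
      pathComponentIn {z ∈ D | g ≤ G z} u ⊆ convexHull ℝ (Q ∪ M) ∨
        pathComponentIn {z ∈ D | g ≤ G z} u ⊆ convexHull ℝ (Q ∪ (vertexSet D \ M)) := fun u hu =>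
    isPreconnected_iff_subset_of_disjoint_closed.1
      (isPathConnected_pathComponentIn hu).isConnected.isPreconnected _ _
      ((hQ.union (hfin.subset hMV)).isClosed_convexHull ℝ)
      ((hQ.union (hfin.subset sdiff_subset)).isClosed_convexHull ℝ)
      (fun x hx => hD.mem_convexHull_union_or hQ hQM hMV (pathComponentIn_subset hx).1)
      (eq_empty_of_forall_notMem fun x hx =>
        (hQg x (hD.mem_convexHull_of_mem_of_mem hQ hQM hMV hx.2.1 hx.2.2)).not_ge
          (pathComponentIn_subset hx.1).2)
  have hsub : pathComponentIn {z ∈ D | g ≤ G z} v ⊆ convexHull ℝ (Q ∪ M) := by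
    have hvS : v ∈ {z ∈ D | g ≤ G z} := ⟨hVD hv, hg⟩
    refine (hsplit v hvS).resolve_right fun h => ?_
    exact (hQg v (hD.mem_convexHull_of_mem_of_mem hQ hQM hMV
      (subset_convexHull ℝ _ (Or.inr mem_labelReach_self))
      (h (mem_pathComponentIn_self hvS)))).not_ge hg
  refine Subset.antisymm (fun x hx => ⟨hsub hx, (pathComponentIn_subset hx).2⟩) ?_
  rintro x ⟨hx, hgx⟩
  have hxD : x ∈ D := convexHull_min (union_subset hQD (hMV.trans hVD)) hD.convex hx
  -- It remains to show `w ∈ M`. If the component of `w` lay in the other hull, `x` would be in both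
  -- hulls, hence in `conv Q`. Otherwise the vertex `w` is a generator of `conv (Q ∪ M)`, and not
  -- one from `Q`.
  obtain ⟨w, hw, hwx⟩ := hD.exists_vertex_precedes hG.1 ⟨x, hxD⟩
  have hjoin := hwx.joinedIn (g := g) hgx
  have hwM : w.1 ∈ M := by
    rcases hsplit w.1 hjoin.source_mem with h | h
    · refine (hD.mem_of_vertex_mem_convexHull (union_subset hQD (hMV.trans hVD)) hw
        (h (mem_pathComponentIn_self hjoin.source_mem))).resolve_left fun h => ?_
      exact (hQg w (subset_convexHull ℝ _ h)).not_ge hjoin.source_mem.2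
    · exact absurd hgx (hQg x (hD.mem_convexHull_of_mem_of_mem hQ hQM hMV hx (h hjoin))).not_ge
  exact (joinedIn_of_mem_labelReach hD.convex hcont (hVD hv) hg hwM).trans hjoin

theorem IsPolytope.pathComponentIn_inter_vertexSet (hD : IsPolytope D) (hcont : ContinuousOn G D)
    (hG : StrictlyConvexIn D G) (hv : v ∈ vertexSet D) (hg : g ≤ G v) :
    pathComponentIn {z ∈ D | g ≤ G z} v ∩ vertexSet D = labelReach D G g v := by
  have hMV : labelReach D G g v ⊆ vertexSet D := labelReach_subset_vertexSet hv
  refine Subset.antisymm ?_ fun w hw =>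
    ⟨joinedIn_of_mem_labelReach hD.convex hcont hv.1 hg hw, hMV hw⟩
  rintro w ⟨hw, hwV⟩
  rw [hD.pathComponentIn_eq hcont hG hv hg] at hw
  refine (hD.mem_of_vertex_mem_convexHull (union_subset (outerMinimizers_subset hD.convex _)
    fun x hx => (hMV hx).1) hwV hw.1).resolve_left fun h => ?_
  exact (lt_of_mem_outerMinimizers hD.convex hcont h).not_ge hw.2

end Components

/-! ### Levels of the components and the chains they form. -/

/-- `p` minimizes the continuous and strictly convex function `G` on the polytope `D`. -/
structure IsStrictMinimizer {n : ℕ} (D : Set (EuclideanSpace ℝ (Fin n)))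
    (G : EuclideanSpace ℝ (Fin n) → ℝ) (p : EuclideanSpace ℝ (Fin n)) : Prop where
  isPolytope : IsPolytope D
  continuousOn : ContinuousOn G D
  strictlyConvexIn : StrictlyConvexIn D G
  mem : p ∈ D
  le : ∀ z ∈ D, G p ≤ G z

/-- The vertices of the component `W(x)`. -/
def upperVertices {n : ℕ} (D : Set (EuclideanSpace ℝ (Fin n)))
    (G : EuclideanSpace ℝ (Fin n) → ℝ) (x : EuclideanSpace ℝ (Fin n)) :
    Set (EuclideanSpace ℝ (Fin n)) :=
  upperComponent D G x ∩ vertexSet D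

/-- The components, for some level of `G`, which contain `M`. -/
def componentsAbove {n : ℕ} (D : Set (EuclideanSpace ℝ (Fin n)))
    (G : EuclideanSpace ℝ (Fin n) → ℝ) (M : Set (EuclideanSpace ℝ (Fin n))) :
    Set (Set (EuclideanSpace ℝ (Fin n))) :=
  {N | M ⊆ N ∧ ∃ g, (g, N) ∈ treePairs D G}

section Tree

variable {n : ℕ} {D : Set (EuclideanSpace ℝ (Fin n))} {G : EuclideanSpace ℝ (Fin n) → ℝ}
  {p : EuclideanSpace ℝ (Fin n)} {g h : ℝ} {v : EuclideanSpace ℝ (Fin n)}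
  {M N : Set (EuclideanSpace ℝ (Fin n))}

theorem upperComponent_eq_pathComponentIn (x : EuclideanSpace ℝ (Fin n)) :
    upperComponent D G x = pathComponentIn {z ∈ D | G x ≤ G z} x := by
  have : D \ sublevelSet D G (G x) = {z ∈ D | G x ≤ G z} := by
    ext z
    simp only [sublevelSet, mem_sdiff, mem_ofPred_eq, not_and, not_lt]
    tauto
  rw [upperComponent, this]

/-- To the left of every level the set of edges with labels at least this level is constant. -/
theorem IsPolytope.exists_labelRel_eq (hD : IsPolytope D) (g : ℝ) :
    ∃ g' < g, ∀ h, g' < h → h ≤ g → LabelRel D G h = LabelRel D G g := by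
  have hfin := hD.finite_vertexSet
  obtain ⟨g', hg', hmax⟩ := exists_max_image
    -- `g'` is the largest label below `g`; `g - 1` serves when there is none.
    (insert (g - 1) {l | l ∈ (fun q : EuclideanSpace ℝ (Fin n) × EuclideanSpace ℝ (Fin n) =>
      edgeLabel G q.1 q.2) '' (vertexSet D ×ˢ vertexSet D) ∧ l < g}) id
    ((((hfin.prod hfin).image _).subset fun l hl => hl.1).insert _) ⟨_, mem_insert _ _⟩
  refine ⟨g', ?_, fun h h1 h2 => ?_⟩
  · rcases hg' with rfl | hg'
    · linarith
    · exact hg'.2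
  · ext v w
    refine ⟨fun ⟨hv, hw, hadj, hle⟩ => ⟨hv, hw, hadj, ?_⟩, LabelRel.mono h2⟩
    by_contra! hlt
    have : edgeLabel G v w ≤ g' :=
      hmax _ (mem_insert_of_mem _ ⟨⟨(v, w), ⟨hv, hw⟩, rfl⟩, hlt⟩)
    linarith

namespace IsStrictMinimizer

theorem mem_treePairs_iff (S : IsStrictMinimizer D G p) :
    (g, M) ∈ treePairs D G ↔ G p ≤ g ∧ ∃ v ∈ vertexSet D, g ≤ G v ∧ M = labelReach D G g v := by
  have hinf : sInf (G '' D) = G p :=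
    IsLeast.csInf_eq ⟨mem_image_of_mem G S.mem, by rintro _ ⟨z, hz, rfl⟩; exact S.le z hz⟩
  have hbdd : BddAbove (G '' D) := (S.isPolytope.isCompact.image_of_continuousOn
    S.continuousOn).bddAbove
  simp only [treePairs, mem_ofPred_eq, hinf,
    isComponentVertexSet_iff S.isPolytope.convex S.continuousOn]
  refine ⟨fun ⟨h1, _, h3⟩ => ⟨h1, h3⟩, fun ⟨h1, h3⟩ => ⟨h1, ?_, h3⟩⟩
  obtain ⟨v, hv, hg, -⟩ := h3
  exact hg.trans (le_csSup hbdd (mem_image_of_mem G hv.1))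

theorem subset_vertexSet (S : IsStrictMinimizer D G p) (hM : (g, M) ∈ treePairs D G) :
    M ⊆ vertexSet D := by
  obtain ⟨-, v, hv, -, rfl⟩ := S.mem_treePairs_iff.1 hM
  exact labelReach_subset_vertexSet hv

theorem exists_mem (S : IsStrictMinimizer D G p) (hM : (g, M) ∈ treePairs D G) :
    ∃ v, v ∈ M := by
  obtain ⟨-, v, hv, -, rfl⟩ := S.mem_treePairs_iff.1 hM
  exact ⟨v, mem_labelReach_self⟩

theorem le_of_mem (S : IsStrictMinimizer D G p) (hM : (g, M) ∈ treePairs D G) (hv : v ∈ M) :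
    g ≤ G v := by
  obtain ⟨-, w, hw, hg, rfl⟩ := S.mem_treePairs_iff.1 hM
  exact le_of_mem_labelReach S.isPolytope.convex S.continuousOn hg hv

theorem eq_labelReach (S : IsStrictMinimizer D G p) (hM : (g, M) ∈ treePairs D G) (hv : v ∈ M) :
    M = labelReach D G g v := by
  obtain ⟨-, w, hw, hg, rfl⟩ := S.mem_treePairs_iff.1 hM
  exact (labelReach_eq hv).symm

theorem labelReach_mem_treePairs (S : IsStrictMinimizer D G p) (hp : G p ≤ g)
    (hv : v ∈ vertexSet D) (hg : g ≤ G v) : (g, labelReach D G g v) ∈ treePairs D G :=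
  S.mem_treePairs_iff.2 ⟨hp, v, hv, hg, rfl⟩

theorem exists_vertex_joinedIn (S : IsStrictMinimizer D G p) {x : EuclideanSpace ℝ (Fin n)}
    (hx : x ∈ D) : ∃ v ∈ vertexSet D, G x ≤ G v ∧ JoinedIn {z ∈ D | G x ≤ G z} v x := by
  obtain ⟨v, hv, hvx⟩ := S.isPolytope.exists_vertex_precedes S.strictlyConvexIn.1 ⟨x, hx⟩
  exact ⟨v, hv, hvx.le, hvx.joinedIn le_rfl⟩

theorem upperVertices_eq (S : IsStrictMinimizer D G p) {x : EuclideanSpace ℝ (Fin n)}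
    (hv : v ∈ vertexSet D) (hj : JoinedIn {z ∈ D | G x ≤ G z} v x) :
    upperVertices D G x = labelReach D G (G x) v := by
  rw [upperVertices, upperComponent_eq_pathComponentIn, pathComponentIn_congr hj,
    S.isPolytope.pathComponentIn_inter_vertexSet S.continuousOn S.strictlyConvexIn hv
      hj.source_mem.2]

theorem coord_mem_treePairs (S : IsStrictMinimizer D G p) {x : EuclideanSpace ℝ (Fin n)}
    (hx : x ∈ D) : (G x, upperVertices D G x) ∈ treePairs D G := by
  obtain ⟨v, hv, hg, hj⟩ := S.exists_vertex_joinedIn hx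
  rw [S.upperVertices_eq hv hj]
  exact S.labelReach_mem_treePairs (S.le x hx) hv hg

/-- This is `pathComponentIn_eq` at the level of `x` itself, and yields every description of a
preimage under `π`. -/
theorem upperVertices_eq_iff (S : IsStrictMinimizer D G p) {x : EuclideanSpace ℝ (Fin n)}
    (hM : (G x, M) ∈ treePairs D G) :
    upperVertices D G x = M ↔ x ∈ convexHull ℝ (outerMinimizers D G M ∪ M) := by
  obtain ⟨v, hv⟩ := S.exists_mem hM
  have hvV := S.subset_vertexSet hM hv
  have hg := S.le_of_mem hM hv
  obtain rfl := S.eq_labelReach hM hv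
  have key := S.isPolytope.pathComponentIn_eq S.continuousOn S.strictlyConvexIn hvV hg
  constructor
  · intro h
    have h1 : v ∈ upperVertices D G x := h ▸ hv
    rw [upperVertices, upperComponent_eq_pathComponentIn] at h1
    have h2 : x ∈ pathComponentIn {z ∈ D | G x ≤ G z} v := h1.1.symm
    rw [key] at h2
    exact h2.1
  · intro h
    have h2 : x ∈ pathComponentIn {z ∈ D | G x ≤ G z} v := by
      rw [key]
      exact ⟨h, le_rfl⟩
    exact S.upperVertices_eq hvV h2

/-- A common vertex suffices to join `W(x)` to `W(y)` above the level of `y`, and `W(x)` always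
contains a vertex. -/
theorem precedes_iff (S : IsStrictMinimizer D G p) {x y : D} :
    Precedes D G x y ↔ G y ≤ G x ∧ upperVertices D G x ⊆ upperVertices D G y := by
  rw [precedes_iff_joinedIn S.strictlyConvexIn S.continuousOn (p := ⟨p, S.mem⟩) S.le]
  simp only [upperVertices, upperComponent_eq_pathComponentIn]
  constructor
  · intro hj
    have hle : G y ≤ G x := hj.source_mem.2
    exact ⟨hle, fun w hw => ⟨hj.symm.trans
      (hw.1.mono fun z hz => ⟨hz.1, hle.trans hz.2⟩), hw.2⟩⟩
  · rintro ⟨hle, hsub⟩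
    obtain ⟨v, hv, -, hj⟩ := S.exists_vertex_joinedIn x.2
    have h1 : JoinedIn {z ∈ D | G y ≤ G z} y.1 v := (hsub ⟨hj.symm, hv⟩).1
    exact ((h1.trans (hj.mono fun z hz => ⟨hz.1, hle.trans hz.2⟩))).symm

theorem exists_coord_eq (S : IsStrictMinimizer D G p) (hM : (g, M) ∈ treePairs D G) :
    ∃ x : D, G x = g ∧ upperVertices D G x = M := by
  obtain ⟨v, hv⟩ := S.exists_mem hM
  have hvV := S.subset_vertexSet hM hv
  obtain ⟨x, rfl, hvx⟩ := exists_precedes_of_mem_Icc S.strictlyConvexIn.1 S.continuousOn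
    (p := ⟨p, S.mem⟩) S.le ⟨v, hvV.1⟩ ⟨(S.mem_treePairs_iff.1 hM).1, S.le_of_mem hM hv⟩
  exact ⟨x, rfl, (S.upperVertices_eq hvV (hvx.joinedIn le_rfl)).trans (S.eq_labelReach hM hv).symm⟩

/-- The set reached at level `h` is squeezed between those at levels `b` and `a`, both equal to `M`.
-/
theorem mem_treePairs_of_le_of_le (S : IsStrictMinimizer D G p) {a b : ℝ}
    (ha : (a, M) ∈ treePairs D G) (hb : (b, M) ∈ treePairs D G) (hah : a ≤ h) (hhb : h ≤ b) :
    (h, M) ∈ treePairs D G := by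
  obtain ⟨v, hv⟩ := S.exists_mem hb
  have heq : M = labelReach D G h v := by
    refine Subset.antisymm ?_ ?_
    · conv_lhs => rw [S.eq_labelReach hb hv]
      exact labelReach_anti hhb
    · conv_rhs => rw [S.eq_labelReach ha hv]
      exact labelReach_anti hah
  rw [heq]
  exact S.labelReach_mem_treePairs ((S.mem_treePairs_iff.1 ha).1.trans hah)
    (S.subset_vertexSet hb hv) (hhb.trans (S.le_of_mem hb hv))

theorem subset_of_le (S : IsStrictMinimizer D G p) (hM : (g, M) ∈ treePairs D G)
    (hN : (h, N) ∈ treePairs D G) (hgh : g ≤ h) (hvM : v ∈ M) (hvN : v ∈ N) : N ⊆ M := by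
  rw [S.eq_labelReach hM hvM, S.eq_labelReach hN hvN]
  exact labelReach_anti hgh

theorem min_vertexSet_mem_treePairs (S : IsStrictMinimizer D G p) :
    (G p, vertexSet D) ∈ treePairs D G := by
  have h := S.coord_mem_treePairs S.mem
  have : upperVertices D G p = vertexSet D := by
    refine Subset.antisymm inter_subset_right fun v hv => ⟨?_, hv⟩
    rw [upperComponent_eq_pathComponentIn]
    exact JoinedIn.of_segment_subset fun z hz =>
      have hzD := S.isPolytope.convex.segment_subset S.mem hv.1 hz
      ⟨hzD, S.le z hzD⟩
  rwa [this] at h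

theorem bddBelow (S : IsStrictMinimizer D G p) (M : Set (EuclideanSpace ℝ (Fin n))) :
    BddBelow {g | (g, M) ∈ treePairs D G} :=
  ⟨G p, fun _ hg => (S.mem_treePairs_iff.1 hg).1⟩

theorem lowerValue_le (S : IsStrictMinimizer D G p) (hM : (g, M) ∈ treePairs D G) :
    lowerValue D G M ≤ g :=
  csInf_le (S.bddBelow M) hM

theorem le_lowerValue (S : IsStrictMinimizer D G p) (hM : (g, M) ∈ treePairs D G) :
    G p ≤ lowerValue D G M :=
  le_csInf ⟨g, hM⟩ fun _ hg => (S.mem_treePairs_iff.1 hg).1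

theorem le_upperValue (S : IsStrictMinimizer D G p) (hM : (g, M) ∈ treePairs D G) :
    g ≤ upperValue D G M := by
  obtain ⟨v, hv⟩ := S.exists_mem hM
  exact le_csSup ⟨G v, fun _ h => S.le_of_mem h hv⟩ hM

/-- The relation `LabelRel` is constant just below each level, so the supremum is attained. -/
theorem upperValue_mem (S : IsStrictMinimizer D G p) (hM : (g, M) ∈ treePairs D G) :
    (upperValue D G M, M) ∈ treePairs D G := by
  obtain ⟨v, hv⟩ := S.exists_mem hM
  obtain ⟨g', hg', heq⟩ := S.isPolytope.exists_labelRel_eq (G := G) (upperValue D G M)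
  obtain ⟨h, hh, hlt⟩ := exists_lt_of_lt_csSup ⟨g, hM⟩ hg'
  have h1 : M = labelReach D G (upperValue D G M) v := by
    conv_lhs => rw [S.eq_labelReach hh hv, labelReach, heq h hlt (S.le_upperValue hh)]
    rfl
  have h2 := S.labelReach_mem_treePairs (g := upperValue D G M) (v := v)
    ((S.mem_treePairs_iff.1 hM).1.trans (S.le_upperValue hM)) (S.subset_vertexSet hM hv)
    (csSup_le ⟨g, hM⟩ fun _ h => S.le_of_mem h hv)
  rwa [← h1] at h2

theorem lowerValue_vertexSet (S : IsStrictMinimizer D G p) :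
    lowerValue D G (vertexSet D) = G p :=
  le_antisymm (S.lowerValue_le S.min_vertexSet_mem_treePairs)
    (S.le_lowerValue S.min_vertexSet_mem_treePairs)

/-- Left constancy of `LabelRel` would allow a slightly lower level. Only the bound `G p` could
prevent this, and at that level the sole component is `D₀`. -/
theorem lowerValue_notMem (S : IsStrictMinimizer D G p) (hM : M ≠ vertexSet D) :
    (lowerValue D G M, M) ∉ treePairs D G := by
  intro h
  obtain ⟨v, hv⟩ := S.exists_mem h
  have hvV := S.subset_vertexSet h hv
  have hlt : G p < lowerValue D G M := by
    refine lt_of_le_of_ne (S.le_lowerValue h) fun heq => hM ?_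
    rw [S.eq_labelReach h hv, ← heq, ← S.eq_labelReach S.min_vertexSet_mem_treePairs hvV]
  obtain ⟨g', hg', heq⟩ := S.isPolytope.exists_labelRel_eq (G := G) (lowerValue D G M)
  obtain ⟨a, ha, ha'⟩ := exists_between (max_lt hlt hg')
  have h1 : M = labelReach D G a v := by
    conv_lhs => rw [S.eq_labelReach h hv, labelReach, ← heq a ((le_max_right _ _).trans_lt ha)
      ha'.le]
    rfl
  have h2 := S.labelReach_mem_treePairs (g := a) (v := v) ((le_max_left _ _).trans ha.le) hvV
    (ha'.le.trans (S.le_of_mem h hv))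
  rw [← h1] at h2
  exact ha'.not_ge (S.lowerValue_le h2)

theorem mem_treePairs_of_lowerValue_lt (S : IsStrictMinimizer D G p) (hg : (g, M) ∈ treePairs D G)
    (h1 : lowerValue D G M < h) (h2 : h ≤ g) : (h, M) ∈ treePairs D G := by
  obtain ⟨a, ha, hah⟩ := exists_lt_of_csInf_lt ⟨g, hg⟩ h1
  exact S.mem_treePairs_of_le_of_le ha hg hah.le h2

theorem mem_treePairs_and_le_iff (S : IsStrictMinimizer D G p) (hg : (g, M) ∈ treePairs D G)
    (hM : M ≠ vertexSet D) : (h, M) ∈ treePairs D G ∧ h ≤ g ↔ h ∈ Ioc (lowerValue D G M) g := by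
  refine ⟨fun ⟨h1, h2⟩ => ⟨lt_of_le_of_ne (S.lowerValue_le h1) ?_, h2⟩,
    fun ⟨h1, h2⟩ => ⟨S.mem_treePairs_of_lowerValue_lt hg h1 h2, h2⟩⟩
  rintro rfl
  exact S.lowerValue_notMem hM h1

theorem vertexSet_mem_treePairs_and_le_iff (S : IsStrictMinimizer D G p)
    (hg : (g, vertexSet D) ∈ treePairs D G) :
    (h, vertexSet D) ∈ treePairs D G ∧ h ≤ g ↔ h ∈ Icc (lowerValue D G (vertexSet D)) g := by
  refine ⟨fun ⟨h1, h2⟩ => ⟨S.lowerValue_le h1, h2⟩, fun ⟨h1, h2⟩ => ⟨?_, h2⟩⟩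
  rw [S.lowerValue_vertexSet] at h1
  exact S.mem_treePairs_of_le_of_le S.min_vertexSet_mem_treePairs hg h1 h2

theorem le_of_ssubset (S : IsStrictMinimizer D G p) (hM : (g, M) ∈ treePairs D G)
    (hN : (h, N) ∈ treePairs D G) (hMN : M ⊂ N) : h ≤ g := by
  obtain ⟨v, hv⟩ := S.exists_mem hM
  by_contra! hlt
  exact hMN.2 (S.subset_of_le hM hN hlt.le hv (hMN.1 hv))

theorem finite_componentsAbove (S : IsStrictMinimizer D G p)
    (M : Set (EuclideanSpace ℝ (Fin n))) : (componentsAbove D G M).Finite :=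
  S.isPolytope.finite_vertexSet.finite_subsets.subset fun _ ⟨_, _, hN⟩ => S.subset_vertexSet hN

/-- Two components sharing a vertex are nested, the one of lower level being the larger. -/
theorem componentsAbove_total (S : IsStrictMinimizer D G p) (hM : (g, M) ∈ treePairs D G)
    {N N' : Set (EuclideanSpace ℝ (Fin n))} (hN : N ∈ componentsAbove D G M)
    (hN' : N' ∈ componentsAbove D G M) : N ⊆ N' ∨ N' ⊆ N := by
  obtain ⟨v, hv⟩ := S.exists_mem hM
  obtain ⟨h1, a, ha⟩ := hN
  obtain ⟨h2, b, hb⟩ := hN'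
  rcases le_total a b with h | h
  · exact Or.inr (S.subset_of_le ha hb h (h1 hv) (h2 hv))
  · exact Or.inl (S.subset_of_le hb ha h (h2 hv) (h1 hv))

theorem exists_strictMono_range_eq (S : IsStrictMinimizer D G p) (hM : (g, M) ∈ treePairs D G) :
    ∃ (k : ℕ) (C : Fin (k + 1) → Set (EuclideanSpace ℝ (Fin n))),
      StrictMono C ∧ range C = componentsAbove D G M := by
  classical
  have := (S.finite_componentsAbove M).fintype
  let inst : LinearOrder (componentsAbove D G M) :=
    { (inferInstance : PartialOrder (componentsAbove D G M)) with
      le_total := fun a b => S.componentsAbove_total hM a.2 b.2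
      toDecidableLE := Classical.decRel _ }
  have hne : 0 < Fintype.card (componentsAbove D G M) :=
    Fintype.card_pos_iff.2 ⟨⟨M, subset_rfl, g, hM⟩⟩
  obtain ⟨k, hk⟩ := Nat.exists_eq_succ_of_ne_zero hne.ne'
  let e := Fintype.orderIsoFinOfCardEq (componentsAbove D G M) hk
  refine ⟨k, fun i => (e i).1, fun i j hij => e.strictMono hij, ?_⟩
  ext N
  refine ⟨?_, fun hN => ⟨e.symm ⟨N, hN⟩, by simp⟩⟩
  rintro ⟨i, rfl⟩
  exact (e i).2

theorem isLowerChain_of_range_eq (hM : (g, M) ∈ treePairs D G) {k : ℕ}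
    {C : Fin (k + 1) → Set (EuclideanSpace ℝ (Fin n))} (hC : StrictMono C)
    (hr : range C = componentsAbove D G M) : IsLowerChain D G M C := by
  have hmem : ∀ i, C i ∈ componentsAbove D G M := fun i => hr ▸ mem_range_self i
  refine ⟨?_, hC, fun i => (hmem i).2⟩
  obtain ⟨i, hi⟩ : M ∈ range C := by
    rw [hr]
    exact ⟨subset_rfl, g, hM⟩
  exact Subset.antisymm ((hC.monotone (Fin.zero_le i)).trans hi.le) (hmem 0).1

theorem range_subset_of_isLowerChain {k : ℕ}
    {C : Fin (k + 1) → Set (EuclideanSpace ℝ (Fin n))} (hC : IsLowerChain D G M C) :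
    range C ⊆ componentsAbove D G M := by
  rintro _ ⟨i, rfl⟩
  exact ⟨hC.1.symm.le.trans (hC.2.1.monotone (Fin.zero_le i)), hC.2.2 i⟩

/-- The maximal lower chain of `M` consists of all components containing `M`. -/
theorem isMaximalLowerChain_iff (S : IsStrictMinimizer D G p) (hM : (g, M) ∈ treePairs D G) {k : ℕ}
    {C : Fin (k + 1) → Set (EuclideanSpace ℝ (Fin n))} :
    IsMaximalLowerChain D G M C ↔ StrictMono C ∧ range C = componentsAbove D G M := by
  constructor
  · rintro ⟨hC, hmax⟩
    obtain ⟨l, C', hC', hr⟩ := S.exists_strictMono_range_eq hM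
    refine ⟨hC.2.1, ?_⟩
    rw [← hr]
    refine (hmax l C' (isLowerChain_of_range_eq hM hC' hr) ?_).symm
    rw [hr]
    exact range_subset_of_isLowerChain hC
  · rintro ⟨hC, hr⟩
    refine ⟨isLowerChain_of_range_eq hM hC hr, fun l C' hC' hsub => Subset.antisymm ?_ hsub⟩
    rw [hr]
    exact range_subset_of_isLowerChain hC'

theorem existsUnique_isMaximalLowerChain (S : IsStrictMinimizer D G p)
    (hM : (g, M) ∈ treePairs D G) :
    ∃! c : (k : ℕ) × (Fin (k + 1) → Set (EuclideanSpace ℝ (Fin n))),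
      IsMaximalLowerChain D G M c.2 := by
  obtain ⟨k, C, hC⟩ := S.exists_strictMono_range_eq hM
  refine ⟨⟨k, C⟩, (S.isMaximalLowerChain_iff hM).2 hC, ?_⟩
  rintro ⟨l, C'⟩ hC'
  have hC' := (S.isMaximalLowerChain_iff hM).1 hC'
  have hcard : l + 1 = k + 1 := by
    have h1 := Nat.card_range_of_injective hC.1.injective
    have h2 := Nat.card_range_of_injective hC'.1.injective
    rw [hC.2] at h1
    rw [hC'.2] at h2
    simpa using h2.symm.trans h1
  obtain rfl : l = k := by omega
  congr
  exact (hC'.1.range_inj hC.1).1 (hC'.2.trans hC.2.symm)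

theorem eq_vertexSet_iff (S : IsStrictMinimizer D G p) (hM : (g, M) ∈ treePairs D G) {k : ℕ}
    {C : Fin (k + 1) → Set (EuclideanSpace ℝ (Fin n))} (hC : StrictMono C)
    (hr : range C = componentsAbove D G M) (i : Fin (k + 1)) :
    C i = vertexSet D ↔ i = Fin.last k := by
  have hlast : C (Fin.last k) = vertexSet D := by
    have hmem : C (Fin.last k) ∈ componentsAbove D G M := hr ▸ mem_range_self _
    obtain ⟨j, hj⟩ : vertexSet D ∈ range C := by
      rw [hr]
      exact ⟨S.subset_vertexSet hM, _, S.min_vertexSet_mem_treePairs⟩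
    obtain ⟨-, a, ha⟩ := hmem
    exact Subset.antisymm (S.subset_vertexSet ha) (hj.symm.le.trans (hC.monotone (Fin.le_last j)))
  refine ⟨fun h => hC.injective (h.trans hlast.symm), ?_⟩
  rintro rfl
  exact hlast

/-- There is no gap between consecutive intervals. At the level `lowerValue D G (C j.castSucc)`, not
attained by `C j.castSucc`, the component is strictly larger, so it contains `C j.succ`. It is also
contained in `C j.succ`, whose levels are all at most this one. -/
theorem lowerValue_mem_treePairs_succ (S : IsStrictMinimizer D G p)
    {k : ℕ} {C : Fin (k + 1) → Set (EuclideanSpace ℝ (Fin n))} (hC : StrictMono C)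
    (hr : range C = componentsAbove D G M) (j : Fin k) :
    (lowerValue D G (C j.castSucc), C j.succ) ∈ treePairs D G := by
  have hmem : ∀ i, C i ∈ componentsAbove D G M := fun i => hr ▸ mem_range_self i
  have hlt : C j.castSucc ⊂ C j.succ := hC j.castSucc_lt_succ
  obtain ⟨hM1, a, ha⟩ := hmem j.castSucc
  obtain ⟨hM2, b, hb⟩ := hmem j.succ
  obtain ⟨v, hv⟩ := S.exists_mem ha
  have hne : C j.castSucc ≠ vertexSet D := fun heq =>
    hlt.2 (heq ▸ S.subset_vertexSet hb)
  have hla := S.lowerValue_le ha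
  have hN := S.labelReach_mem_treePairs (S.le_lowerValue ha) (S.subset_vertexSet ha hv)
    (hla.trans (S.le_of_mem ha hv))
  have hsub : C j.castSucc ⊆ labelReach D G (lowerValue D G (C j.castSucc)) v :=
    S.subset_of_le hN ha hla mem_labelReach_self hv
  obtain ⟨i, hi⟩ : labelReach D G (lowerValue D G (C j.castSucc)) v ∈ range C := by
    rw [hr]
    exact ⟨hM1.trans hsub, _, hN⟩
  have hij : j.castSucc < i := by
    by_contra! hle
    refine S.lowerValue_notMem hne ?_
    have := Subset.antisymm hsub (hi.symm.le.trans (hC.monotone hle))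
    rwa [← this] at hN
  have hb' : b ≤ lowerValue D G (C j.castSucc) :=
    le_csInf ⟨a, ha⟩ fun a' ha' => S.le_of_ssubset ha' hb hlt
  have heq : C j.succ = labelReach D G (lowerValue D G (C j.castSucc)) v :=
    Subset.antisymm ((hC.monotone (Fin.castSucc_lt_iff_succ_le.1 hij)).trans hi.le)
      (S.subset_of_le hb hN hb' (hlt.1 hv) mem_labelReach_self)
  rw [heq]
  exact hN

theorem mem_chainInterval_iff (S : IsStrictMinimizer D G p) (hM : (g, M) ∈ treePairs D G)
    {k : ℕ} {C : Fin (k + 1) → Set (EuclideanSpace ℝ (Fin n))} (hC : StrictMono C)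
    (hr : range C = componentsAbove D G M) (i : Fin (k + 1)) :
    h ∈ chainInterval D G g C i ↔ (h, C i) ∈ treePairs D G ∧ h ≤ g := by
  have hmem : ∀ i, C i ∈ componentsAbove D G M := fun i => hr ▸ mem_range_self i
  have hC0 : C 0 = M := (isLowerChain_of_range_eq hM hC hr).1
  -- Here `u` stands for the upper end of the interval. The lower end is included exactly for `C i =
  -- D₀`, whose lowest level `G p` is attained.
  have hkey : ∀ u, (u, C i) ∈ treePairs D G →
      (h ∈ (if i = Fin.last k then Icc (lowerValue D G (C i)) u
        else Ioc (lowerValue D G (C i)) u) ↔ (h, C i) ∈ treePairs D G ∧ h ≤ u) := fun u hu => by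
    by_cases hi : i = Fin.last k
    · have heq := (S.eq_vertexSet_iff hM hC hr i).2 hi
      rw [if_pos hi, heq]
      rw [heq] at hu
      exact (S.vertexSet_mem_treePairs_and_le_iff hu).symm
    · rw [if_neg hi, S.mem_treePairs_and_le_iff hu (mt (S.eq_vertexSet_iff hM hC hr i).1 hi)]
  induction i using Fin.cases with
  | zero => exact hkey g (hC0.symm ▸ hM)
  | succ j =>
    -- For later members both upper bounds hold automatically, since a strictly larger component has
    -- levels no higher than those of a smaller one.
    refine (hkey _ (S.lowerValue_mem_treePairs_succ hC hr j)).trans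
      (and_congr_right fun hh => ?_)
    obtain ⟨hM1, a, ha⟩ := hmem j.castSucc
    have h1 : h ≤ lowerValue D G (C j.castSucc) :=
      le_csInf ⟨a, ha⟩ fun a' ha' => S.le_of_ssubset ha' hh (hC j.castSucc_lt_succ)
    have h2 : h ≤ g := S.le_of_ssubset hM hh (hC0 ▸ hC (Fin.succ_pos j))
    exact ⟨fun _ => h2, fun _ => h1⟩

end IsStrictMinimizer

end Tree

/-! ### Coordinates on the tree, preimages and attainable sets. -/

section Coordinates

variable {n : ℕ} {D : Set (EuclideanSpace ℝ (Fin n))} {G : EuclideanSpace ℝ (Fin n) → ℝ}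
  {p : EuclideanSpace ℝ (Fin n)} {g : ℝ} {M : Set (EuclideanSpace ℝ (Fin n))}

theorem ThermoTree.coord_treeProj (x : D) :
    (treeProj D G x).coord = (G x, upperVertices D G x) := rfl

theorem treeProj_surjective : Function.Surjective (treeProj D G) := Quotient.exists_rep

namespace IsStrictMinimizer

/-- Injectivity is `precedes_iff` read in both directions; surjectivity comes from descending from a
vertex of `M` to level `g`. -/
theorem bijOn_coord (S : IsStrictMinimizer D G p) :
    BijOn (ThermoTree.coord : ThermoTree D G → _) univ (treePairs D G) := by
  refine ⟨fun z _ => ?_, fun z _ w _ hzw => ?_, fun ⟨g, M⟩ hM => ?_⟩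
  · obtain ⟨x, rfl⟩ := treeProj_surjective z
    exact S.coord_mem_treePairs x.2
  · obtain ⟨x, rfl⟩ := treeProj_surjective z
    obtain ⟨y, rfl⟩ := treeProj_surjective w
    obtain ⟨h1, h2⟩ := Prod.ext_iff.1 hzw
    have h1 : G x = G y := h1
    have h2 : upperVertices D G x = upperVertices D G y := h2
    exact Quotient.sound ⟨S.precedes_iff.2 ⟨h1.ge, h2.le⟩, S.precedes_iff.2 ⟨h1.le, h2.ge⟩⟩
  · obtain ⟨x, rfl, rfl⟩ := S.exists_coord_eq hM
    exact ⟨treeProj D G x, mem_univ _, rfl⟩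

theorem convexHull_outerMinimizers_union_subset (S : IsStrictMinimizer D G p)
    (hM : (g, M) ∈ treePairs D G) : convexHull ℝ (outerMinimizers D G M ∪ M) ⊆ D :=
  convexHull_min (union_subset (outerMinimizers_subset S.isPolytope.convex M)
    fun _ hx => (S.subset_vertexSet hM hx).1) S.isPolytope.convex

theorem coe_preimage_prod (S : IsStrictMinimizer D G p) {H : Set ℝ}
    (hne : (g, M) ∈ treePairs D G) (hH : H ×ˢ {M} ⊆ treePairs D G) :
    Subtype.val '' (treeProj D G ⁻¹' (ThermoTree.coord ⁻¹' (H ×ˢ {M}))) =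
      {x ∈ convexHull ℝ (outerMinimizers D G M ∪ M) | G x ∈ H} := by
  ext x
  constructor
  · rintro ⟨x, ⟨h1, h2⟩, rfl⟩
    exact ⟨(S.upperVertices_eq_iff (hH (show (G x, M) ∈ H ×ˢ {M} from ⟨h1, rfl⟩))).1 h2, h1⟩
  · rintro ⟨h1, h2⟩
    exact ⟨⟨x, S.convexHull_outerMinimizers_union_subset hne h1⟩,
      ⟨h2, (S.upperVertices_eq_iff (hH (show (G x, M) ∈ H ×ˢ {M} from ⟨h2, rfl⟩))).2 h1⟩, rfl⟩

theorem coe_preimage_singleton (S : IsStrictMinimizer D G p) {z : ThermoTree D G}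
    (hz : z.coord = (g, M)) : Subtype.val '' (treeProj D G ⁻¹' {z}) =
      {x ∈ convexHull ℝ (outerMinimizers D G M ∪ M) | G x = g} := by
  have hM : (g, M) ∈ treePairs D G := hz ▸ S.bijOn_coord.mapsTo (mem_univ z)
  have h1 : ({g} : Set ℝ) ×ˢ {M} ⊆ treePairs D G := by
    rintro ⟨a, N⟩ ⟨rfl, rfl⟩
    exact hM
  have h2 : ({z} : Set (ThermoTree D G)) = ThermoTree.coord ⁻¹' (({g} : Set ℝ) ×ˢ {M}) := by
    ext w
    rw [singleton_prod_singleton, ← hz]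
    exact ⟨fun h => congrArg _ h, fun h => S.bijOn_coord.injOn (mem_univ _) (mem_univ _) h⟩
  rw [h2, S.coe_preimage_prod hM h1]
  rfl

theorem prod_subset_treePairs (S : IsStrictMinimizer D G p) {H : Set ℝ}
    (hM : (g, M) ∈ treePairs D G) (hH : H ⊆ Ioc (lowerValue D G M) (upperValue D G M) ∨
      (M = vertexSet D ∧ H ⊆ Icc (lowerValue D G M) (upperValue D G M))) :
    H ×ˢ {M} ⊆ treePairs D G := by
  rintro ⟨h, N⟩ ⟨hh, rfl⟩
  have hu := S.upperValue_mem hM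
  rcases hH with hH | ⟨rfl, hH⟩
  · exact S.mem_treePairs_of_lowerValue_lt hu (hH hh).1 (hH hh).2
  · exact (S.vertexSet_mem_treePairs_and_le_iff hu).2 (hH hh) |>.1

/-- By `precedes_iff`, attainability means that the vertex set of `y` contains that of `x`, so it is
some `C i`, at a level not above `G x`. Such levels form the chain interval. -/
theorem precedes_iff_exists_chain (S : IsStrictMinimizer D G p) {x : D} {k : ℕ}
    {C : Fin (k + 1) → Set (EuclideanSpace ℝ (Fin n))}
    (hC : IsMaximalLowerChain D G (upperVertices D G x) C) (y : D) :
    Precedes D G x y ↔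
      ∃ i, G y ∈ chainInterval D G (G x) C i ∧ upperVertices D G y = C i := by
  have hM := S.coord_mem_treePairs x.2
  obtain ⟨hC, hr⟩ := (S.isMaximalLowerChain_iff hM).1 hC
  rw [S.precedes_iff]
  have hy := S.coord_mem_treePairs y.2
  constructor
  · rintro ⟨hle, hsub⟩
    obtain ⟨i, hi⟩ : upperVertices D G y ∈ range C := by
      rw [hr]
      exact ⟨hsub, _, hy⟩
    exact ⟨i, (S.mem_chainInterval_iff hM hC hr i).2 ⟨hi ▸ hy, hle⟩, hi.symm⟩
  · rintro ⟨i, hi, heq⟩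
    have hmem : C i ∈ componentsAbove D G (upperVertices D G x) := hr ▸ mem_range_self i
    exact ⟨((S.mem_chainInterval_iff hM hC hr i).1 hi).2, heq ▸ hmem.1⟩

theorem coord_image_attainableSet (S : IsStrictMinimizer D G p) {x : D} {k : ℕ}
    {C : Fin (k + 1) → Set (EuclideanSpace ℝ (Fin n))}
    (hC : IsMaximalLowerChain D G (upperVertices D G x) C) :
    ThermoTree.coord '' (treeProj D G x).attainableSet =
      ⋃ i, chainInterval D G (G x) C i ×ˢ {C i} := by
  ext ⟨h, N⟩
  simp only [mem_iUnion]
  constructor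
  · rintro ⟨w, hw, heq⟩
    obtain ⟨y, rfl⟩ := treeProj_surjective w
    obtain ⟨i, hi, hi'⟩ := (S.precedes_iff_exists_chain hC y).1 hw
    rw [← heq]
    exact ⟨i, hi, hi'⟩
  · rintro ⟨i, hi, rfl⟩
    have hM := S.coord_mem_treePairs x.2
    obtain ⟨hmono, hr⟩ := (S.isMaximalLowerChain_iff hM).1 hC
    obtain ⟨y, rfl, hy⟩ :=
      S.exists_coord_eq ((S.mem_chainInterval_iff hM hmono hr i).1 hi).1
    refine ⟨treeProj D G y, (S.precedes_iff_exists_chain hC y).2 ⟨i, hi, hy⟩, ?_⟩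
    rw [ThermoTree.coord_treeProj, hy]

theorem coe_attainableSet (S : IsStrictMinimizer D G p) {x : D} {k : ℕ}
    {C : Fin (k + 1) → Set (EuclideanSpace ℝ (Fin n))}
    (hC : IsMaximalLowerChain D G (upperVertices D G x) C) :
    Subtype.val '' attainableSet D G x =
      ⋃ i, {y ∈ convexHull ℝ (outerMinimizers D G (C i) ∪ C i) |
        G y ∈ chainInterval D G (G x) C i} := by
  have hM := S.coord_mem_treePairs x.2
  obtain ⟨hmono, hr⟩ := (S.isMaximalLowerChain_iff hM).1 hC
  have hpair := fun {h : ℝ} {i} (hi : h ∈ chainInterval D G (G x) C i) =>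
    ((S.mem_chainInterval_iff hM hmono hr i).1 hi).1
  ext y
  simp only [mem_iUnion]
  constructor
  · rintro ⟨y, hy, rfl⟩
    obtain ⟨i, hi, hi'⟩ := (S.precedes_iff_exists_chain hC y).1 hy
    exact ⟨i, (S.upperVertices_eq_iff (hpair hi)).1 hi', hi⟩
  · rintro ⟨i, h1, hi⟩
    exact ⟨⟨y, S.convexHull_outerMinimizers_union_subset (hpair hi) h1⟩,
      (S.precedes_iff_exists_chain hC _).2 ⟨i, hi, (S.upperVertices_eq_iff (hpair hi)).2 h1⟩, rfl⟩

end IsStrictMinimizer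

end Coordinates

theorem mainTheorem8 (n : ℕ) (D : Set (EuclideanSpace ℝ (Fin n))) (hD : IsPolytope D)
    (G : EuclideanSpace ℝ (Fin n) → ℝ) (hGcont : ContinuousOn G D)
    (hG : StrictlyConvexIn D G) :
    -- the pairs `(g, M)` are coordinates on the tree
    BijOn (ThermoTree.coord : ThermoTree D G → _) univ (treePairs D G) ∧
    -- the preimage of a point `(g, M)` of the tree
    (∀ (z : ThermoTree D G) (g : ℝ) (M : Set (EuclideanSpace ℝ (Fin n))), z.coord = (g, M) →
      Subtype.val '' (treeProj D G ⁻¹' {z}) =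
        {x ∈ convexHull ℝ (outerMinimizers D G M ∪ M) | G x = g}) ∧
    -- the preimage of a set `H × M`
    (∀ (M : Set (EuclideanSpace ℝ (Fin n))) (H : Set ℝ), (∃ g, (g, M) ∈ treePairs D G) →
      (H ⊆ Ioc (lowerValue D G M) (upperValue D G M) ∨
        (M = vertexSet D ∧ H ⊆ Icc (lowerValue D G M) (upperValue D G M))) →
      H ×ˢ {M} ⊆ treePairs D G ∧
      Subtype.val '' (treeProj D G ⁻¹' (ThermoTree.coord ⁻¹' (H ×ˢ {M}))) =
        {x ∈ convexHull ℝ (outerMinimizers D G M ∪ M) | G x ∈ H}) ∧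
    -- the maximal lower chain of a component exists, is unique, and ends in the set of all vertices
    (∀ M : Set (EuclideanSpace ℝ (Fin n)), (∃ g, (g, M) ∈ treePairs D G) →
      (∃! c : (k : ℕ) × (Fin (k + 1) → Set (EuclideanSpace ℝ (Fin n))),
        IsMaximalLowerChain D G M c.2) ∧
      ∀ (k : ℕ) (C : Fin (k + 1) → Set (EuclideanSpace ℝ (Fin n))),
        IsMaximalLowerChain D G M C → C (Fin.last k) = vertexSet D) ∧
    -- the attainable sets
    (∀ x : D, attainableSet D G x = treeProj D G ⁻¹' (treeProj D G x).attainableSet) ∧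
    (∀ (z : ThermoTree D G) (g : ℝ) (M : Set (EuclideanSpace ℝ (Fin n))), z.coord = (g, M) →
      ∀ (k : ℕ) (C : Fin (k + 1) → Set (EuclideanSpace ℝ (Fin n))),
        IsMaximalLowerChain D G M C →
        ThermoTree.coord '' z.attainableSet = ⋃ i, chainInterval D G g C i ×ˢ {C i} ∧
        ∀ x : D, treeProj D G x = z →
          Subtype.val '' attainableSet D G x =
            ⋃ i, {y ∈ convexHull ℝ (outerMinimizers D G (C i) ∪ C i) |
              G y ∈ chainInterval D G g C i}) := by
  obtain ⟨p, hp, hmin⟩ := hD.isCompact.exists_isMinOn hD.nonempty hGcont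
  have S : IsStrictMinimizer D G p := ⟨hD, hGcont, hG, hp, fun z hz => hmin hz⟩
  -- The identity `Att(x) = π⁻¹(Att(π x))` is definitional, as the order on the quotient is lifted
  -- from `D`.
  refine ⟨S.bijOn_coord, fun z g M hz => S.coe_preimage_singleton hz, ?_, ?_, fun x => rfl, ?_⟩
  · rintro M H ⟨g, hM⟩ hH
    have hsub := S.prod_subset_treePairs hM hH
    exact ⟨hsub, S.coe_preimage_prod hM hsub⟩
  · rintro M ⟨g, hM⟩
    refine ⟨S.existsUnique_isMaximalLowerChain hM, fun k C hC => ?_⟩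
    obtain ⟨hmono, hr⟩ := (S.isMaximalLowerChain_iff hM).1 hC
    exact (S.eq_vertexSet_iff hM hmono hr _).2 rfl
  · intro z g M hz k C hC
    have key : ∀ x : D, treeProj D G x = z →
        g = G x ∧ IsMaximalLowerChain D G (upperVertices D G x) C := by
      rintro x rfl
      rw [ThermoTree.coord_treeProj, Prod.mk.injEq] at hz
      exact ⟨hz.1.symm, hz.2.symm ▸ hC⟩
    refine ⟨?_, fun x hx => ?_⟩
    · obtain ⟨x, rfl⟩ := treeProj_surjective z
      obtain ⟨rfl, hC'⟩ := key x rfl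
      exact S.coord_image_attainableSet hC'
    · obtain ⟨rfl, hC'⟩ := key x hx
      exact S.coe_attainableSet hC'
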